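/- Let $T>0$, $x\in\mathbb R$, $\sigma_0\in\mathbb R\setminus\{0\}$, and let $b:[0,T]\times\mathbb R\times\mathbb R\to\mathbb R$ be Borel measurable. For a path $w:[0,T]\to\mathbb R$ write $M^w_t=\sup_{0\le s\le t}w_s$ for its running maximum, and let $|w|$ denote the path $s\mapsto|w_s|$. Assume: 1. there is a constant $C>0$ such that $|b(t,M^w_t,w_t)|\le C\,(1+M^{|w|}_t)$ for all $t\in[0,T]$ and all $w\in C([0,T];\mathbb R)$; 2. for each $t\in[0,T]$, the function $b(t,\cdot,\cdot)$ is nondecreasing in each of its two arguments. Then the path-dependent SDE $$X_t=x+\int_0^t b(s,M^X_s,X_s)\,ds+\sigma_0B_t,\qquad 0\le t\le T,$$ has a unique strong solution, and it satisfies $\mathbb E[\|X\|_\infty^2]<\infty$, where $\|X\|_\infty=\sup_{0\le t\le T}|X_t|$. That is, on every probability space $(\Omega,\mathcal F,\mathbb P)$ carrying a one-dimensional Brownian motion $B=(B_t)_{t\in[0,T]}$ there is a process $X$ with a.s. continuous paths, adapted to the $\mathbb P$-completed natural filtration of $B$, which almost surely satisfies the equation for all $t\in[0,T]$ and for which $\mathbb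 E[\|X\|_\infty^2]<\infty$; and if $Y$ is any process with a.s. continuous paths which almost surely satisfies the equation for all $t\in[0,T]$ and is adapted to some filtration with respect to which $B$ is a Brownian motion, then almost surely $Y_t=X_t$ for all $t\in[0,T]$. -/

import Mathlib

open MeasureTheory ProbabilityTheory
open scoped ENNReal NNReal

namespace MaxSDE

/-- The time interval `[0, T]`, with the order, topology and σ-algebra inherited from `ℝ`. -/
abbrev Time (T : ℝ) : Type := Set.Icc (0 : ℝ) T

/-- Lebesgue measure on `[0, T]`. -/
noncomputable def lebesgue (T : ℝ) : Measure (Time T) :=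
  Measure.comap (fun t : Time T ↦ (t : ℝ)) volume

/-- The running maximum `M^w_t = sup_{0 ≤ s ≤ t} w_s` of a path `w` on `[0, T]`. -/
noncomputable def runningMax {T : ℝ} (w : Time T → ℝ) (t : Time T) : ℝ :=
  sSup (w '' Set.Iic t)

/-- `B = (B_t)_{t ∈ [0, T]}` is a standard one-dimensional Brownian motion with respect to the
filtration `𝓕 = (𝓕_t)_{t ∈ [0, T]}` and the probability measure `P`. -/
structure IsBrownianMotion {T : ℝ} {Ω : Type*} {m : MeasurableSpace Ω}
    (𝓕 : Filtration (Time T) m) (P : Measure Ω) (B : Time T → Ω → ℝ) : Prop where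
  adapted : StronglyAdapted 𝓕 B
  start_zero : ∀ t : Time T, (t : ℝ) = 0 → ∀ᵐ ω ∂P, B t ω = 0
  continuous_paths : ∀ᵐ ω ∂P, Continuous (fun t ↦ B t ω)
  increment_law : ∀ s t : Time T, s ≤ t →
    HasLaw (fun ω ↦ B t ω - B s ω) (gaussianReal 0 (Real.toNNReal ((t : ℝ) - s))) P
  increment_indep : ∀ s t : Time T, s ≤ t →
    Indep (MeasurableSpace.comap (fun ω ↦ B t ω - B s ω) inferInstance) (𝓕 s) P

theorem IsBrownianMotion.stronglyMeasurable {T : ℝ} {Ω : Type*} {m : MeasurableSpace Ω}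
    {𝓕 : Filtration (Time T) m} {P : Measure Ω} {B : Time T → Ω → ℝ}
    (hB : IsBrownianMotion 𝓕 P B) (t : Time T) : StronglyMeasurable (B t) :=
  (hB.adapted t).mono (𝓕.le t)

/-- The σ-algebra generated by the `P`-null events. -/
abbrev nullSigmaAlgebra {Ω : Type*} {m : MeasurableSpace Ω} (P : Measure Ω) : MeasurableSpace Ω :=
  MeasurableSpace.generateFrom {N | MeasurableSet[m] N ∧ P N = 0}

theorem nullSigmaAlgebra_le {Ω : Type*} {m : MeasurableSpace Ω} (P : Measure Ω) :
    nullSigmaAlgebra P ≤ m :=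
  MeasurableSpace.generateFrom_le fun _ hN ↦ hN.1

/-- The `P`-completed natural filtration of a process `B`: at time `t` it is generated by
`(B_s)_{s ≤ t}` and by the `P`-null events. -/
def completedNaturalFiltration {T : ℝ} {Ω : Type*} {m : MeasurableSpace Ω} (P : Measure Ω)
    (B : Time T → Ω → ℝ) (hB : ∀ t, StronglyMeasurable (B t)) : Filtration (Time T) m :=
  Filtration.natural B hB ⊔ Filtration.const (Time T) (nullSigmaAlgebra P) (nullSigmaAlgebra_le P)

/-- `X` is a solution, adapted to the filtration `𝓖` and with (almost surely) continuous paths, of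
`X_t = x + ∫_0^t b(s, M^X_s, X_s) ds + σ₀ B_t`, `0 ≤ t ≤ T`. Inside the integral `Set.Iic t` is the
interval `[0, t]` of `[0, T]`. -/
structure IsSolution {T : ℝ} {Ω : Type*} {m : MeasurableSpace Ω}
    (b : Time T → ℝ → ℝ → ℝ) (x σ₀ : ℝ) (P : Measure Ω) (B : Time T → Ω → ℝ)
    (𝓖 : Filtration (Time T) m) (X : Time T → Ω → ℝ) : Prop where
  adapted : StronglyAdapted 𝓖 X
  continuous_paths : ∀ᵐ ω ∂P, Continuous (fun t ↦ X t ω)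
  integrable_drift : ∀ᵐ ω ∂P,
    Integrable (fun s : Time T ↦ b s (runningMax (fun u ↦ X u ω) s) (X s ω)) (lebesgue T)
  equation : ∀ᵐ ω ∂P, ∀ t : Time T,
    X t ω = x + (∫ s in Set.Iic t, b s (runningMax (fun u ↦ X u ω) s) (X s ω) ∂(lebesgue T))
      + σ₀ * B t ω

end MaxSDE

/-!
The proof is pathwise, and needs neither Girsanov's theorem nor stochastic integration.

For a continuous path `w` the equation driven by `w` is the fixed point equation of the operator
`picard`, `X ↦ w + ∫₀ b(s, M^X_s, X_s) ds`, which is monotone because `b` is. Started from above and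
from below an a priori bound (`barrier`, a form of Grönwall's inequality), its iterates converge
monotonically to two paths `upperLimit` and `lowerLimit`, which enclose every solution. They need
not be solutions, since `b` may be discontinuous, but when they coincide their common value is the
unique solution (`lowerLimit_eq_of_eq_upperLimit`). Both are measurable and `lowerLimit` is
non-anticipative in `w`. So everything reduces to showing that the two limits coincide almost surely
when `w = x + σ₀ B`.

Since `lowerLimit ≤ upperLimit`, it suffices that `upperLimit` is not stochastically larger than
`lowerLimit`. Adding to `w` the path `c min(·, δ)`, with `c` larger than twice the size of the
drift, pushes the lower limit above the upper limit for the unshifted path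
(`upperLimit_le_lowerLimit_of_shift`): on `(0, δ]` the shift wins against the drift, and from then
on state and running maximum are strictly ordered, so that monotonicity of `b` keeps the order
whatever the discontinuities of `b`. The running maxima are separated because Brownian motion exceeds its
initial value immediately (`IsBrownianPath.ae_exists_le_mul_pos`). On the other hand, the shift
changes the law of Brownian motion by at most the total variation distance between `N(0, 1)` and
`N(c √δ / σ₀, 1)`, since `B` is the sum of `(B_δ / δ) min(·, δ)` and of a bridge independent of
`B_δ` (`IsBrownianPath.measure_add_rampPath_le`). This distance vanishes as `δ → 0` with `c` fixed,
and the probability that the drift is too large for `c` vanishes as `c → ∞`.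

The second moment follows from the a priori bound and a pathwise Doob inequality
(`sq_partialSups_le`) along finer and finer grids.
-/

/-! ### Running maxima and the space of paths -/

namespace MaxSDE

open Set Filter Topology

variable {T : ℝ}

theorem le_runningMax {w : Time T → ℝ} (hw : Continuous w) {r t : Time T} (h : r ≤ t) :
    w r ≤ runningMax w t :=
  le_csSup (isClosed_Iic.isCompact.bddAbove_image hw.continuousOn) (mem_image_of_mem w h)

theorem runningMax_le {w : Time T → ℝ} {t : Time T} {a : ℝ} (h : ∀ r ≤ t, w r ≤ a) :
    runningMax w t ≤ a :=
  csSup_le (nonempty_Iic.image w) (by rintro _ ⟨r, hr, rfl⟩; exact h r hr)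

theorem exists_runningMax_eq {w : Time T → ℝ} (hw : Continuous w) (t : Time T) :
    ∃ r ≤ t, runningMax w t = w r :=
  isClosed_Iic.isCompact.exists_sSup_image_eq nonempty_Iic hw.continuousOn

theorem runningMax_mono {w v : Time T → ℝ} (hv : Continuous v) {t : Time T}
    (h : ∀ r ≤ t, w r ≤ v r) : runningMax w t ≤ runningMax v t :=
  runningMax_le fun r hr ↦ (h r hr).trans (le_runningMax hv hr)

theorem runningMax_congr {w v : Time T → ℝ} {t : Time T} (h : ∀ r ≤ t, w r = v r) :
    runningMax w t = runningMax v t := by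
  unfold runningMax
  rw [image_congr fun r hr ↦ h r (mem_Iic.1 hr)]

theorem runningMax_eq_sSup_univ (w : Time T → ℝ) (t : Time T) :
    runningMax w t = sSup ((fun r ↦ w (min r t)) '' univ) := by
  unfold runningMax
  congr 1
  ext y
  constructor
  · rintro ⟨r, hr, rfl⟩
    exact ⟨r, mem_univ _, by simp [min_eq_left (mem_Iic.1 hr)]⟩
  · rintro ⟨r, -, rfl⟩
    exact ⟨min r t, mem_Iic.2 (min_le_right _ _), rfl⟩

theorem continuous_runningMax {w : Time T → ℝ} (hw : Continuous w) :
    Continuous (runningMax w) := by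
  have : runningMax w = fun t ↦ sSup ((fun t r ↦ w (min r t)) t '' univ) :=
    funext fun t ↦ runningMax_eq_sSup_univ w t
  rw [this]
  exact isCompact_univ.continuous_sSup (f := fun t r ↦ w (min r t))
    (hw.comp (continuous_snd.min continuous_fst))

theorem continuous_runningMax_path (t : Time T) :
    Continuous fun w : C(Time T, ℝ) ↦ runningMax w t :=
  isClosed_Iic.isCompact.continuous_sSup (f := fun (w : C(Time T, ℝ)) r ↦ w r) continuous_eval

theorem monotone_runningMax {w : Time T → ℝ} (hw : Continuous w) : Monotone (runningMax w) :=
  fun _ _ h ↦ runningMax_le fun _ hr ↦ le_runningMax hw (hr.trans h)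

/-- Continuous induction on `[0, T]`, in the form of a first exit time argument. -/
theorem forall_pos_of_forall_lt {f : Time T → ℝ} (hf : Continuous f)
    (h : ∀ t, (∀ s < t, 0 < f s) → 0 < f t) (t : Time T) : 0 < f t := by
  by_contra hneg
  obtain ⟨t₀, ht₀, hmin⟩ : ∃ t₀, IsLeast {t | f t ≤ 0} t₀ :=
    (isClosed_le hf continuous_const).isCompact.exists_isLeast ⟨t, not_lt.1 hneg⟩
  exact absurd (h t₀ fun s hs ↦ not_le.1 fun hs' ↦ (hmin hs').not_gt hs) (not_lt.2 ht₀)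

/-- The σ-algebra on the space of paths generated by the evaluations. -/
instance pathMeasurableSpace : MeasurableSpace C(Time T, ℝ) :=
  MeasurableSpace.comap (fun w t ↦ w t) MeasurableSpace.pi

theorem measurable_eval_path (t : Time T) : Measurable fun w : C(Time T, ℝ) ↦ w t :=
  (measurable_pi_apply t).comp (comap_measurable fun (w : C(Time T, ℝ)) (t : Time T) ↦ w t)

theorem measurable_path_iff {α : Type*} {mα : MeasurableSpace α} {F : α → C(Time T, ℝ)} :
    Measurable F ↔ ∀ t, Measurable fun a ↦ F a t :=
  ⟨fun h t ↦ (measurable_eval_path t).comp h,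
    fun h ↦ measurable_comap_iff.2 (measurable_pi_iff.2 h)⟩

theorem measurable_uncurry_path :
    Measurable fun p : Time T × C(Time T, ℝ) ↦ p.2 p.1 :=
  measurable_uncurry_of_continuous_of_measurable (u := fun t (w : C(Time T, ℝ)) ↦ w t)
    (fun w ↦ w.continuous) measurable_eval_path

theorem measurable_runningMax_path (t : Time T) :
    Measurable fun w : C(Time T, ℝ) ↦ runningMax w t := by
  refine measurable_of_Iic fun a ↦ ?_
  have : Nonempty (Time T) := ⟨t⟩
  have : (fun w : C(Time T, ℝ) ↦ runningMax w t) ⁻¹' Iic a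
      = ⋂ n, (fun w : C(Time T, ℝ) ↦ w (min (TopologicalSpace.denseSeq (Time T) n) t)) ⁻¹'
        Iic a := by
    ext w
    simp only [mem_preimage, mem_Iic, mem_iInter]
    refine ⟨fun h n ↦ (le_runningMax w.continuous (min_le_right _ _)).trans h, fun h ↦ ?_⟩
    have hcl : IsClosed {r : Time T | w (min r t) ≤ a} :=
      isClosed_le (w.continuous.comp (continuous_id.min continuous_const)) continuous_const
    have huniv : {r : Time T | w (min r t) ≤ a} = univ :=
      eq_univ_of_univ_subset <| by
        rw [← (TopologicalSpace.denseRange_denseSeq (Time T)).closure_eq]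
        exact hcl.closure_subset_iff.2 (by rintro _ ⟨n, rfl⟩; exact h n)
    refine runningMax_le fun r hr ↦ ?_
    have : r ∈ {r : Time T | w (min r t) ≤ a} := huniv ▸ mem_univ r
    simpa [min_eq_left hr] using this
  rw [this]
  exact MeasurableSet.iInter fun n ↦ measurable_eval_path _ measurableSet_Iic

theorem measurable_uncurry_runningMax :
    Measurable fun p : Time T × C(Time T, ℝ) ↦ runningMax p.2 p.1 :=
  measurable_uncurry_of_continuous_of_measurable (u := fun t (w : C(Time T, ℝ)) ↦ runningMax w t)
    (fun w ↦ continuous_runningMax w.continuous) measurable_runningMax_path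

/-- The path `w` frozen at time `t`. -/
def stopPath (t : Time T) (w : C(Time T, ℝ)) : C(Time T, ℝ) :=
  ⟨fun s ↦ w (min s t), w.continuous.comp (continuous_id.min continuous_const)⟩

/-! ### Integration over `[0, t]` -/

instance : IsFiniteMeasure (lebesgue T) := by
  refine ⟨?_⟩
  rw [lebesgue, comap_subtype_coe_apply measurableSet_Icc, image_univ, Subtype.range_coe]
  exact measure_Icc_lt_top

instance : NullSingletonClass (lebesgue T) := by
  refine ⟨fun t ↦ ?_⟩
  rw [lebesgue, comap_subtype_coe_apply measurableSet_Icc]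
  simp

theorem setIntegral_Iic_lebesgue (g : ℝ → ℝ) (t : Time T) :
    ∫ s in Iic t, g s ∂lebesgue T = ∫ s in (0 : ℝ)..t, g s := by
  rw [intervalIntegral.integral_of_le t.2.1, ← integral_Icc_eq_integral_Ioc,
    ← integral_indicator measurableSet_Iic, ← integral_indicator measurableSet_Icc]
  have h1 : (Iic t).indicator (fun s : Time T ↦ g s)
      = fun s : Time T ↦ (Icc (0 : ℝ) t).indicator g s := by
    ext s
    by_cases hs : s ≤ t
    · rw [indicator_of_mem (mem_Iic.2 hs), indicator_of_mem (show (s : ℝ) ∈ Icc (0 : ℝ) t from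
        ⟨s.2.1, hs⟩)]
    · rw [indicator_of_notMem (by simpa using hs), indicator_of_notMem]
      exact fun h ↦ hs h.2
  rw [h1, lebesgue]
  change ∫ x : Icc (0 : ℝ) T, (Icc (0 : ℝ) t).indicator g (x : ℝ)
    ∂(Measure.comap Subtype.val volume) = _
  rw [integral_subtype_comap measurableSet_Icc (fun x ↦ (Icc (0 : ℝ) t).indicator g x),
    ← integral_indicator measurableSet_Icc, indicator_indicator,
    inter_eq_self_of_subset_right (Icc_subset_Icc_right t.2.2)]

theorem setIntegral_Iic_lebesgue_eq_zero {o : Time T} (ho : (o : ℝ) = 0) (g : Time T → ℝ) :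
    ∫ s in Iic o, g s ∂lebesgue T = 0 := by
  have : Iic o = {o} := by
    ext s
    simp only [mem_Iic, mem_singleton_iff]
    refine ⟨fun h ↦ le_antisymm h ?_, fun h ↦ h.le⟩
    rw [← Subtype.coe_le_coe, ho]
    exact s.2.1
  rw [this]
  rw [Measure.restrict_eq_zero.2 (measure_singleton o), integral_zero_measure]

theorem integrable_lebesgue_of_bound {g : Time T → ℝ} (hg : Measurable g) {K : ℝ}
    (hK : ∀ s, |g s| ≤ K) : Integrable g (lebesgue T) :=
  Integrable.of_bound hg.aestronglyMeasurable K (ae_of_all _ hK)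

theorem continuous_setIntegral_Iic {g : Time T → ℝ} (hg : Integrable g (lebesgue T)) :
    Continuous fun t : Time T ↦ ∫ s in Iic t, g s ∂lebesgue T := by
  rcases isEmpty_or_nonempty (Time T) with h | ⟨⟨o, ho⟩⟩
  · exact continuous_of_const fun x ↦ h.elim x
  have hT : 0 ≤ T := ho.1.trans ho.2
  set g' : ℝ → ℝ := IccExtend hT g
  have hgg' : ∀ s : Time T, g' s = g s := fun s ↦ IccExtend_val hT g s
  have hint : IntervalIntegrable g' volume 0 T := by
    rw [intervalIntegrable_iff_integrableOn_Icc_of_le hT]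
    rw [← integrableOn_univ, lebesgue] at hg
    have := (MeasurableEmbedding.subtype_coe
      (measurableSet_Icc (a := (0 : ℝ)) (b := T))).integrable_map_iff
      (μ := Measure.comap (Subtype.val : Icc (0 : ℝ) T → ℝ) volume) (g := g')
    rw [map_comap_subtype_coe measurableSet_Icc] at this
    refine this.2 ?_
    rw [integrableOn_univ] at hg
    convert! hg using 1
    ext s
    exact hgg' s
  have : (fun t : Time T ↦ ∫ s in Iic t, g s ∂lebesgue T)
      = fun t : Time T ↦ ∫ s in (0 : ℝ)..t, g' s := by
    ext t
    rw [← setIntegral_Iic_lebesgue]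
    simp_rw [hgg']
  rw [this]
  have hc : ContinuousOn (fun t : ℝ ↦ ∫ s in (0 : ℝ)..t, g' s) (Icc 0 T) := by
    have := intervalIntegral.continuousOn_primitive_interval (μ := volume) (f := g')
      (a := 0) (b := T)
      (by rw [uIcc_of_le hT]; exact (intervalIntegrable_iff_integrableOn_Icc_of_le hT).1 hint)
    rwa [uIcc_of_le hT] at this
  exact continuousOn_iff_continuous_domRestrict.1 hc

theorem setIntegral_Iic_mono_fun {g g' : Time T → ℝ} (hg : Integrable g (lebesgue T))
    (hg' : Integrable g' (lebesgue T)) {t : Time T} (h : ∀ s < t, g s ≤ g' s) :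
    ∫ s in Iic t, g s ∂lebesgue T ≤ ∫ s in Iic t, g' s ∂lebesgue T := by
  rw [integral_Iic_eq_integral_Iio, integral_Iic_eq_integral_Iio]
  exact setIntegral_mono_on hg.integrableOn hg'.integrableOn measurableSet_Iio h

theorem setIntegral_Iic_const (K : ℝ) (t : Time T) :
    ∫ _ in Iic t, K ∂lebesgue T = K * t := by
  rw [setIntegral_Iic_lebesgue (fun _ ↦ K)]
  simp [mul_comm]

end MaxSDE

/-! ### The Picard operator -/

namespace MaxSDE

open Set Filter Topology

variable {T : ℝ} {b : Time T → ℝ → ℝ → ℝ} {C : ℝ}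

/-- The standing assumptions on the drift coefficient: measurability, linear growth along
continuous paths with constant `C`, and monotonicity in the running maximum and in the state. -/
structure DriftConditions (b : Time T → ℝ → ℝ → ℝ) (C : ℝ) : Prop where
  measurable : Measurable fun p : Time T × ℝ × ℝ ↦ b p.1 p.2.1 p.2.2
  pos : 0 < C
  growth : ∀ (t : Time T) (w : C(Time T, ℝ)),
    |b t (runningMax w t) (w t)| ≤ C * (1 + runningMax (fun s ↦ |w s|) t)
  mono_max : ∀ (t : Time T) (y : ℝ), Monotone fun a ↦ b t a y
  mono_state : ∀ (t : Time T) (a : ℝ), Monotone fun y ↦ b t a y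

/-- The drift along the path `X`, as a function of time. -/
noncomputable def pathDrift (b : Time T → ℝ → ℝ → ℝ) (X : Time T → ℝ) (s : Time T) : ℝ :=
  b s (runningMax X s) (X s)

theorem DriftConditions.le_of_le (h : DriftConditions b C) (s : Time T) {a a' y y' : ℝ}
    (ha : a ≤ a') (hy : y ≤ y') : b s a y ≤ b s a' y' :=
  (h.mono_max s y ha).trans (h.mono_state s a' hy)

theorem DriftConditions.pathDrift_mono (h : DriftConditions b C) {X Y : Time T → ℝ}
    (hY : Continuous Y) {s : Time T} (hXY : ∀ r ≤ s, X r ≤ Y r) :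
    pathDrift b X s ≤ pathDrift b Y s :=
  h.le_of_le s (runningMax_mono hY hXY) (hXY s le_rfl)

theorem DriftConditions.measurable_pathDrift (h : DriftConditions b C) (X : C(Time T, ℝ)) :
    Measurable (pathDrift b X) :=
  h.measurable.comp (measurable_id.prodMk
    ((continuous_runningMax X.continuous).measurable.prodMk X.continuous.measurable))

theorem DriftConditions.abs_pathDrift_le (h : DriftConditions b C) (X : C(Time T, ℝ)) {s : Time T}
    {K : ℝ} (hX : ∀ r ≤ s, |X r| ≤ K) : |pathDrift b X s| ≤ C * (1 + K) :=
  (h.growth s X).trans <| by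
    have := h.pos
    gcongr
    exact runningMax_le hX

theorem DriftConditions.integrable_pathDrift (h : DriftConditions b C) (X : C(Time T, ℝ)) :
    Integrable (pathDrift b X) (lebesgue T) :=
  integrable_lebesgue_of_bound (h.measurable_pathDrift X) (K := C * (1 + ‖X‖))
    fun _ ↦ h.abs_pathDrift_le X fun r _ ↦ X.norm_coe_le_norm r

/-- The operator `X ↦ w + ∫₀ b(s, M^X_s, X_s) ds`, whose fixed points are the solutions of the
equation driven by the path `w`. -/
noncomputable def picard (h : DriftConditions b C) (w X : C(Time T, ℝ)) : C(Time T, ℝ) :=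
  ⟨fun t ↦ w t + ∫ s in Iic t, pathDrift b X s ∂lebesgue T,
    w.continuous.add (continuous_setIntegral_Iic (h.integrable_pathDrift X))⟩

theorem picard_apply (h : DriftConditions b C) (w X : C(Time T, ℝ)) (t : Time T) :
    picard h w X t = w t + ∫ s in Iic t, pathDrift b X s ∂lebesgue T := rfl

theorem monotone_picard (h : DriftConditions b C) (w : C(Time T, ℝ)) : Monotone (picard h w) := by
  intro X Y hXY t
  change picard h w X t ≤ picard h w Y t
  rw [picard_apply, picard_apply]
  gcongr 1
  exact setIntegral_Iic_mono_fun (h.integrable_pathDrift X) (h.integrable_pathDrift Y)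
    fun s _ ↦ h.pathDrift_mono Y.continuous fun r _ ↦ hXY r

theorem picard_congr (h : DriftConditions b C) {w w' X X' : C(Time T, ℝ)} {t : Time T}
    (hw : ∀ r ≤ t, w r = w' r) (hX : ∀ r ≤ t, X r = X' r) :
    ∀ r ≤ t, picard h w X r = picard h w' X' r := by
  intro r hr
  rw [picard_apply, picard_apply, hw r hr]
  congr 1
  refine setIntegral_congr_fun measurableSet_Iic fun s hs ↦ ?_
  have hs : s ≤ t := (mem_Iic.1 hs).trans hr
  simp only [pathDrift, hX s hs, runningMax_congr fun q (hq : q ≤ s) ↦ hX q (hq.trans hs)]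

theorem measurable_picard (h : DriftConditions b C) {F : C(Time T, ℝ) → C(Time T, ℝ)}
    (hF : Measurable F) : Measurable fun w ↦ picard h w (F w) := by
  refine measurable_path_iff.2 fun t ↦ (measurable_eval_path t).add ?_
  have hjoint : Measurable fun p : C(Time T, ℝ) × Time T ↦ pathDrift b (F p.1) p.2 :=
    h.measurable.comp (measurable_snd.prodMk
      ((measurable_uncurry_runningMax.comp (measurable_snd.prodMk (hF.comp measurable_fst))).prodMk
        (measurable_uncurry_path.comp (measurable_snd.prodMk (hF.comp measurable_fst)))))
  exact (hjoint.stronglyMeasurable.integral_prod_right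
    (ν := (lebesgue T).restrict (Iic t))).measurable

/-- The path `t ↦ (1 + sup_{s ≤ t} |w_s|) exp (2 C t)`, an a priori bound for all solutions of the
equation driven by `w`. -/
noncomputable def barrier (C : ℝ) (w : C(Time T, ℝ)) : C(Time T, ℝ) :=
  ⟨fun t ↦ (1 + runningMax (fun s ↦ |w s|) t) * Real.exp (2 * C * t),
    (continuous_const.add (continuous_runningMax w.continuous.abs)).mul (by fun_prop)⟩

theorem barrier_apply (C : ℝ) (w : C(Time T, ℝ)) (t : Time T) :
    barrier C w t = (1 + runningMax (fun s ↦ |w s|) t) * Real.exp (2 * C * t) := rfl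

theorem abs_le_runningMax_abs (w : C(Time T, ℝ)) (t : Time T) :
    |w t| ≤ runningMax (fun s ↦ |w s|) t :=
  le_runningMax (w := fun s ↦ |w s|) w.continuous.abs le_rfl

theorem one_le_barrier (hC : 0 < C) (w : C(Time T, ℝ)) (t : Time T) : 1 ≤ barrier C w t := by
  have h1 := (abs_nonneg _).trans (abs_le_runningMax_abs w t)
  have h2 : 1 ≤ Real.exp (2 * C * t) := Real.one_le_exp (by have := t.2.1; positivity)
  rw [barrier_apply]
  nlinarith

theorem monotone_barrier (hC : 0 < C) (w : C(Time T, ℝ)) : Monotone (barrier C w) := by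
  intro s t hst
  rw [barrier_apply, barrier_apply]
  have h1 := (abs_nonneg _).trans (abs_le_runningMax_abs w s)
  have h2 := monotone_runningMax (w := fun s ↦ |w s|) w.continuous.abs hst
  have h3 : (s : ℝ) ≤ t := hst
  gcongr
  linarith

theorem setIntegral_Iic_exp (K : ℝ) (t : Time T) :
    ∫ s in Iic t, K * Real.exp (K * s) ∂lebesgue T = Real.exp (K * t) - 1 := by
  rw [setIntegral_Iic_lebesgue (fun s ↦ K * Real.exp (K * s)),
    intervalIntegral.integral_eq_sub_of_hasDerivAt (f := fun s ↦ Real.exp (K * s))]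
  · simp
  · intro s _
    simpa [mul_comm] using ((hasDerivAt_id s).const_mul K).exp
  · exact Continuous.intervalIntegrable (by fun_prop) _ _

/-- A path below the barrier before time `t` is sent by the Picard operator strictly below the
barrier at time `t`. This is Grönwall's inequality in barrier form. -/
theorem abs_picard_le (h : DriftConditions b C) (w X : C(Time T, ℝ)) {t : Time T}
    (hX : ∀ s < t, |X s| ≤ barrier C w s) : |picard h w X t| ≤ barrier C w t - 1 := by
  have hC := h.pos
  set S := 1 + runningMax (fun s ↦ |w s|) t with hS
  have hdrift : ∀ s < t, |pathDrift b X s| ≤ S * (2 * C * Real.exp (2 * C * s)) := by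
    intro s hs
    have h1 : |pathDrift b X s| ≤ C * (1 + barrier C w s) := h.abs_pathDrift_le X fun r hr ↦
      (hX r (hr.trans_lt hs)).trans (monotone_barrier hC w hr)
    have h2 := one_le_barrier hC w s
    have h3 : barrier C w s ≤ S * Real.exp (2 * C * s) := by
      rw [barrier_apply, hS]
      gcongr
      exact monotone_runningMax (w := fun s ↦ |w s|) w.continuous.abs hs.le
    nlinarith
  have hint : |∫ s in Iic t, pathDrift b X s ∂lebesgue T| ≤ S * (Real.exp (2 * C * t) - 1) := by
    rw [← setIntegral_Iic_exp, ← integral_const_mul]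
    refine (abs_integral_le_integral_abs).trans ?_
    refine setIntegral_Iic_mono_fun (h.integrable_pathDrift X).abs ?_ hdrift
    exact integrable_lebesgue_of_bound (by fun_prop)
      (K := |S| * (2 * C * Real.exp (2 * C * T))) fun s ↦ by
        rw [abs_mul]
        have : |2 * C * Real.exp (2 * C * s)| = 2 * C * Real.exp (2 * C * s) :=
          abs_of_nonneg (by positivity)
        rw [this]
        gcongr
        exact s.2.2
  have hw := abs_le_runningMax_abs w t
  rw [picard_apply, barrier_apply]
  refine (abs_add_le _ _).trans ?_
  linarith

theorem abs_le_barrier_of_fixedPoint (h : DriftConditions b C) {w Y : C(Time T, ℝ)}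
    (hY : picard h w Y = Y) (t : Time T) : |Y t| ≤ barrier C w t := by
  have := forall_pos_of_forall_lt (f := fun t ↦ barrier C w t - |Y t|)
    ((barrier C w).continuous.sub Y.continuous.abs) (fun t ht ↦ by
      have := abs_picard_le h w Y (t := t) fun s hs ↦ (sub_pos.1 (ht s hs)).le
      rw [hY] at this
      linarith) t
  linarith

/-! ### Monotone Picard iterations from above and from below -/

/-- The Picard iterates started at the barrier; they decrease. -/
noncomputable def upper (h : DriftConditions b C) (w : C(Time T, ℝ)) (n : ℕ) : C(Time T, ℝ) :=
  (picard h w)^[n] (barrier C w)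

/-- The Picard iterates started at minus the barrier; they increase. -/
noncomputable def lower (h : DriftConditions b C) (w : C(Time T, ℝ)) (n : ℕ) : C(Time T, ℝ) :=
  (picard h w)^[n] (-barrier C w)

theorem upper_succ (h : DriftConditions b C) (w : C(Time T, ℝ)) (n : ℕ) :
    upper h w (n + 1) = picard h w (upper h w n) :=
  Function.iterate_succ_apply' _ _ _

theorem lower_succ (h : DriftConditions b C) (w : C(Time T, ℝ)) (n : ℕ) :
    lower h w (n + 1) = picard h w (lower h w n) :=
  Function.iterate_succ_apply' _ _ _

theorem abs_upper_le (h : DriftConditions b C) (w : C(Time T, ℝ)) (n : ℕ) (t : Time T) :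
    |upper h w n t| ≤ barrier C w t := by
  induction n generalizing t with
  | zero => exact (abs_of_nonneg (zero_le_one.trans (one_le_barrier h.pos w t))).le
  | succ n ih =>
    rw [upper_succ]
    linarith [abs_picard_le h w (upper h w n) (t := t) fun s _ ↦ ih s]

theorem abs_lower_le (h : DriftConditions b C) (w : C(Time T, ℝ)) (n : ℕ) (t : Time T) :
    |lower h w n t| ≤ barrier C w t := by
  induction n generalizing t with
  | zero =>
    refine (abs_neg (barrier C w t)).trans_le ?_
    exact (abs_of_nonneg (zero_le_one.trans (one_le_barrier h.pos w t))).le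
  | succ n ih =>
    rw [lower_succ]
    linarith [abs_picard_le h w (lower h w n) (t := t) fun s _ ↦ ih s]

theorem antitone_upper (h : DriftConditions b C) (w : C(Time T, ℝ)) : Antitone (upper h w) :=
  (monotone_picard h w).antitone_iterate_of_map_le fun t ↦
    (abs_le.1 (abs_upper_le h w 1 t)).2

theorem monotone_lower (h : DriftConditions b C) (w : C(Time T, ℝ)) : Monotone (lower h w) :=
  (monotone_picard h w).monotone_iterate_of_le_map fun t ↦
    (abs_le.1 (abs_lower_le h w 1 t)).1

theorem lower_le_of_fixedPoint (h : DriftConditions b C) {w Y : C(Time T, ℝ)}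
    (hY : picard h w Y = Y) (n : ℕ) : lower h w n ≤ Y := by
  have h1 : -barrier C w ≤ Y := fun t ↦ (abs_le.1 (abs_le_barrier_of_fixedPoint h hY t)).1
  have h2 := (monotone_picard h w).iterate n h1
  rwa [Function.iterate_fixed hY] at h2

theorem le_upper_of_fixedPoint (h : DriftConditions b C) {w Y : C(Time T, ℝ)}
    (hY : picard h w Y = Y) (n : ℕ) : Y ≤ upper h w n := by
  have h1 : Y ≤ barrier C w := fun t ↦ (abs_le.1 (abs_le_barrier_of_fixedPoint h hY t)).2
  have h2 := (monotone_picard h w).iterate n h1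
  rwa [Function.iterate_fixed hY] at h2

/-- The limit of the upper iterates. -/
noncomputable def upperLimit (h : DriftConditions b C) (w : C(Time T, ℝ)) (t : Time T) : ℝ :=
  ⨅ n, upper h w n t

/-- The limit of the lower iterates. -/
noncomputable def lowerLimit (h : DriftConditions b C) (w : C(Time T, ℝ)) (t : Time T) : ℝ :=
  ⨆ n, lower h w n t

/-- The limit of the drifts along the upper iterates. Since `b` need not be continuous, it may
exceed the drift along `upperLimit`. -/
noncomputable def upperDrift (h : DriftConditions b C) (w : C(Time T, ℝ)) (t : Time T) : ℝ :=
  ⨅ n, pathDrift b (upper h w n) t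

/-- The limit of the drifts along the lower iterates. Since `b` need not be continuous, it may
be less than the drift along `lowerLimit`. -/
noncomputable def lowerDrift (h : DriftConditions b C) (w : C(Time T, ℝ)) (t : Time T) : ℝ :=
  ⨆ n, pathDrift b (lower h w n) t

theorem abs_pathDrift_upper_le (h : DriftConditions b C) (w : C(Time T, ℝ)) (n : ℕ) (t : Time T) :
    |pathDrift b (upper h w n) t| ≤ C * (1 + barrier C w t) :=
  h.abs_pathDrift_le _ fun r hr ↦ (abs_upper_le h w n r).trans (monotone_barrier h.pos w hr)

theorem abs_pathDrift_lower_le (h : DriftConditions b C) (w : C(Time T, ℝ)) (n : ℕ) (t : Time T) :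
    |pathDrift b (lower h w n) t| ≤ C * (1 + barrier C w t) :=
  h.abs_pathDrift_le _ fun r hr ↦ (abs_lower_le h w n r).trans (monotone_barrier h.pos w hr)

theorem bddBelow_upper (h : DriftConditions b C) (w : C(Time T, ℝ)) (t : Time T) :
    BddBelow (range fun n ↦ upper h w n t) :=
  ⟨-barrier C w t, by rintro _ ⟨n, rfl⟩; exact (abs_le.1 (abs_upper_le h w n t)).1⟩

theorem bddAbove_lower (h : DriftConditions b C) (w : C(Time T, ℝ)) (t : Time T) :
    BddAbove (range fun n ↦ lower h w n t) :=
  ⟨barrier C w t, by rintro _ ⟨n, rfl⟩; exact (abs_le.1 (abs_lower_le h w n t)).2⟩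

theorem bddBelow_pathDrift_upper (h : DriftConditions b C) (w : C(Time T, ℝ)) (t : Time T) :
    BddBelow (range fun n ↦ pathDrift b (upper h w n) t) :=
  ⟨_, by rintro _ ⟨n, rfl⟩; exact (abs_le.1 (abs_pathDrift_upper_le h w n t)).1⟩

theorem bddAbove_pathDrift_lower (h : DriftConditions b C) (w : C(Time T, ℝ)) (t : Time T) :
    BddAbove (range fun n ↦ pathDrift b (lower h w n) t) :=
  ⟨_, by rintro _ ⟨n, rfl⟩; exact (abs_le.1 (abs_pathDrift_lower_le h w n t)).2⟩

theorem tendsto_upper (h : DriftConditions b C) (w : C(Time T, ℝ)) (t : Time T) :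
    Tendsto (fun n ↦ upper h w n t) atTop (𝓝 (upperLimit h w t)) :=
  tendsto_atTop_ciInf (fun _ _ hmn ↦ antitone_upper h w hmn t) (bddBelow_upper h w t)

theorem tendsto_lower (h : DriftConditions b C) (w : C(Time T, ℝ)) (t : Time T) :
    Tendsto (fun n ↦ lower h w n t) atTop (𝓝 (lowerLimit h w t)) :=
  tendsto_atTop_ciSup (fun _ _ hmn ↦ monotone_lower h w hmn t) (bddAbove_lower h w t)

theorem tendsto_pathDrift_upper (h : DriftConditions b C) (w : C(Time T, ℝ)) (t : Time T) :
    Tendsto (fun n ↦ pathDrift b (upper h w n) t) atTop (𝓝 (upperDrift h w t)) :=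
  tendsto_atTop_ciInf
    (fun m _ hmn ↦ h.pathDrift_mono (upper h w m).continuous fun r _ ↦ antitone_upper h w hmn r)
    (bddBelow_pathDrift_upper h w t)

theorem tendsto_pathDrift_lower (h : DriftConditions b C) (w : C(Time T, ℝ)) (t : Time T) :
    Tendsto (fun n ↦ pathDrift b (lower h w n) t) atTop (𝓝 (lowerDrift h w t)) :=
  tendsto_atTop_ciSup
    (fun _ n hmn ↦ h.pathDrift_mono (lower h w n).continuous fun r _ ↦ monotone_lower h w hmn r)
    (bddAbove_pathDrift_lower h w t)

theorem upperLimit_le (h : DriftConditions b C) (w : C(Time T, ℝ)) (n : ℕ) (t : Time T) :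
    upperLimit h w t ≤ upper h w n t :=
  ciInf_le (bddBelow_upper h w t) n

theorem le_lowerLimit (h : DriftConditions b C) (w : C(Time T, ℝ)) (n : ℕ) (t : Time T) :
    lower h w n t ≤ lowerLimit h w t :=
  le_ciSup (bddAbove_lower h w t) n

theorem lowerLimit_le_of_fixedPoint (h : DriftConditions b C) {w Y : C(Time T, ℝ)}
    (hY : picard h w Y = Y) (t : Time T) : lowerLimit h w t ≤ Y t :=
  ciSup_le fun n ↦ lower_le_of_fixedPoint h hY n t

theorem le_upperLimit_of_fixedPoint (h : DriftConditions b C) {w Y : C(Time T, ℝ)}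
    (hY : picard h w Y = Y) (t : Time T) : Y t ≤ upperLimit h w t :=
  le_ciInf fun n ↦ le_upper_of_fixedPoint h hY n t

theorem lower_le_upper (h : DriftConditions b C) (w : C(Time T, ℝ)) (n : ℕ) :
    lower h w n ≤ upper h w n :=
  (monotone_picard h w).iterate n fun t ↦
    neg_le_self (zero_le_one.trans (one_le_barrier h.pos w t))

theorem lowerLimit_le_upperLimit (h : DriftConditions b C) (w : C(Time T, ℝ)) (t : Time T) :
    lowerLimit h w t ≤ upperLimit h w t :=
  le_of_tendsto_of_tendsto' (tendsto_lower h w t) (tendsto_upper h w t)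
    fun n ↦ lower_le_upper h w n t

theorem abs_lowerLimit_le (h : DriftConditions b C) (w : C(Time T, ℝ)) (t : Time T) :
    |lowerLimit h w t| ≤ barrier C w t :=
  le_of_tendsto' (tendsto_lower h w t).abs fun n ↦ abs_lower_le h w n t

theorem abs_upperDrift_le (h : DriftConditions b C) (w : C(Time T, ℝ)) (t : Time T) :
    |upperDrift h w t| ≤ C * (1 + barrier C w t) :=
  le_of_tendsto' (tendsto_pathDrift_upper h w t).abs fun n ↦ abs_pathDrift_upper_le h w n t

theorem abs_lowerDrift_le (h : DriftConditions b C) (w : C(Time T, ℝ)) (t : Time T) :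
    |lowerDrift h w t| ≤ C * (1 + barrier C w t) :=
  le_of_tendsto' (tendsto_pathDrift_lower h w t).abs fun n ↦ abs_pathDrift_lower_le h w n t

theorem integrable_drift_bound (C : ℝ) (w : C(Time T, ℝ)) :
    Integrable (fun t ↦ C * (1 + barrier C w t)) (lebesgue T) :=
  integrable_lebesgue_of_bound (K := ‖C‖ * (1 + ‖barrier C w‖)) (by fun_prop) fun s ↦ by
    rw [abs_mul]
    refine mul_le_mul_of_nonneg_left ((abs_add_le _ _).trans ?_) (abs_nonneg _)
    rw [abs_one]
    gcongr
    exact (barrier C w).norm_coe_le_norm s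

theorem integrable_upperDrift (h : DriftConditions b C) (w : C(Time T, ℝ)) :
    Integrable (upperDrift h w) (lebesgue T) :=
  (integrable_drift_bound C w).mono'
    (measurable_of_tendsto_metrizable (fun n ↦ h.measurable_pathDrift (upper h w n))
      (tendsto_pi_nhds.2 (tendsto_pathDrift_upper h w))).aestronglyMeasurable
    (ae_of_all _ (abs_upperDrift_le h w))

theorem integrable_lowerDrift (h : DriftConditions b C) (w : C(Time T, ℝ)) :
    Integrable (lowerDrift h w) (lebesgue T) :=
  (integrable_drift_bound C w).mono'
    (measurable_of_tendsto_metrizable (fun n ↦ h.measurable_pathDrift (lower h w n))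
      (tendsto_pi_nhds.2 (tendsto_pathDrift_lower h w))).aestronglyMeasurable
    (ae_of_all _ (abs_lowerDrift_le h w))

theorem upperLimit_eq (h : DriftConditions b C) (w : C(Time T, ℝ)) (t : Time T) :
    upperLimit h w t = w t + ∫ s in Iic t, upperDrift h w s ∂lebesgue T := by
  refine tendsto_nhds_unique ((tendsto_add_atTop_iff_nat 1).2 (tendsto_upper h w t)) ?_
  simp_rw [upper_succ, picard_apply]
  refine tendsto_const_nhds.add (tendsto_integral_of_dominated_convergence
    (fun t ↦ C * (1 + barrier C w t))
    (fun n ↦ (h.measurable_pathDrift (upper h w n)).aestronglyMeasurable)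
    (integrable_drift_bound C w).integrableOn
    (fun n ↦ ae_of_all _ (abs_pathDrift_upper_le h w n))
    (ae_of_all _ (tendsto_pathDrift_upper h w)))

theorem lowerLimit_eq (h : DriftConditions b C) (w : C(Time T, ℝ)) (t : Time T) :
    lowerLimit h w t = w t + ∫ s in Iic t, lowerDrift h w s ∂lebesgue T := by
  refine tendsto_nhds_unique ((tendsto_add_atTop_iff_nat 1).2 (tendsto_lower h w t)) ?_
  simp_rw [lower_succ, picard_apply]
  refine tendsto_const_nhds.add (tendsto_integral_of_dominated_convergence
    (fun t ↦ C * (1 + barrier C w t))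
    (fun n ↦ (h.measurable_pathDrift (lower h w n)).aestronglyMeasurable)
    (integrable_drift_bound C w).integrableOn
    (fun n ↦ ae_of_all _ (abs_pathDrift_lower_le h w n))
    (ae_of_all _ (tendsto_pathDrift_lower h w)))

theorem continuous_upperLimit (h : DriftConditions b C) (w : C(Time T, ℝ)) :
    Continuous (upperLimit h w) := by
  rw [funext (upperLimit_eq h w)]
  exact w.continuous.add (continuous_setIntegral_Iic (integrable_upperDrift h w))

theorem continuous_lowerLimit (h : DriftConditions b C) (w : C(Time T, ℝ)) :
    Continuous (lowerLimit h w) := by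
  rw [funext (lowerLimit_eq h w)]
  exact w.continuous.add (continuous_setIntegral_Iic (integrable_lowerDrift h w))

/-- If the two limits agree, then their common value solves the equation: its drift is squeezed
between `lowerDrift` and `upperDrift`, which have the same integrals. -/
theorem lowerLimit_eq_of_eq_upperLimit (h : DriftConditions b C) (w : C(Time T, ℝ))
    (heq : ∀ t, lowerLimit h w t = upperLimit h w t) (t : Time T) :
    lowerLimit h w t = w t + ∫ s in Iic t, pathDrift b (lowerLimit h w) s ∂lebesgue T := by
  have hint := h.integrable_pathDrift ⟨lowerLimit h w, continuous_lowerLimit h w⟩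
  have hlow : ∀ s, lowerDrift h w s ≤ pathDrift b (lowerLimit h w) s := fun s ↦
    ciSup_le fun n ↦ h.pathDrift_mono (continuous_lowerLimit h w) fun r _ ↦ le_lowerLimit h w n r
  have hup : ∀ s, pathDrift b (lowerLimit h w) s ≤ upperDrift h w s := fun s ↦
    le_ciInf fun n ↦ h.pathDrift_mono (upper h w n).continuous fun r _ ↦
      (heq r).trans_le (upperLimit_le h w n r)
  have h1 := setIntegral_Iic_mono_fun (integrable_lowerDrift h w) hint (t := t) fun s _ ↦ hlow s
  have h2 := setIntegral_Iic_mono_fun hint (integrable_upperDrift h w) (t := t) fun s _ ↦ hup s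
  have h3 := lowerLimit_eq h w t
  have h4 := upperLimit_eq h w t
  have h5 := heq t
  simp only [ContinuousMap.coe_mk] at h1 h2
  linarith

theorem measurable_runningMax_abs (t : Time T) :
    Measurable fun w : C(Time T, ℝ) ↦ runningMax (fun s ↦ |w s|) t :=
  (measurable_runningMax_path t).comp
    (f := fun w : C(Time T, ℝ) ↦ (⟨fun s ↦ |w s|, w.continuous.abs⟩ : C(Time T, ℝ)))
    (measurable_path_iff.2 fun s ↦ (measurable_eval_path s).abs)

theorem measurable_barrier : Measurable fun w : C(Time T, ℝ) ↦ barrier C w :=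
  measurable_path_iff.2 fun t ↦ (measurable_const.add (measurable_runningMax_abs t)).mul_const _

theorem measurable_lowerLimit (h : DriftConditions b C) (t : Time T) :
    Measurable fun w ↦ lowerLimit h w t := by
  refine measurable_of_tendsto_metrizable (f := fun n w ↦ lower h w n t) (fun n ↦ ?_)
    (tendsto_pi_nhds.2 fun w ↦ tendsto_lower h w t)
  refine measurable_path_iff.1 ?_ t
  induction n with
  | zero => exact measurable_path_iff.2 fun t ↦ (measurable_path_iff.1 measurable_barrier t).neg
  | succ n ih =>
    simp_rw [lower_succ]
    exact measurable_picard h ih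

/-- `lowerLimit` is non-anticipative: its value at time `t` depends only on the path up to `t`. -/
theorem lowerLimit_stopPath (h : DriftConditions b C) (w : C(Time T, ℝ)) (t : Time T) :
    lowerLimit h (stopPath t w) t = lowerLimit h w t := by
  have hw : ∀ r ≤ t, stopPath t w r = w r := fun r hr ↦ by simp [stopPath, min_eq_left hr]
  suffices ∀ n, ∀ r ≤ t, lower h (stopPath t w) n r = lower h w n r by
    simp only [lowerLimit, this _ t le_rfl]
  intro n
  induction n with
  | zero =>
    intro r hr
    have : barrier C (stopPath t w) r = barrier C w r := by
      rw [barrier_apply, barrier_apply, runningMax_congr (v := fun s ↦ |w s|) fun q hq ↦ by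
        rw [hw q (hq.trans hr)]]
    simp [lower, this]
  | succ n ih =>
    rw [lower_succ, lower_succ]
    exact picard_congr h hw ih

end MaxSDE

/-! ### Comparison under a small Cameron–Martin shift -/

namespace MaxSDE

open Set Filter Topology

variable {T : ℝ} {b : Time T → ℝ → ℝ → ℝ} {C : ℝ}

/-- The running maxima of the decreasing iterates converge because, by Dini's theorem, the
iterates converge uniformly. -/
theorem tendsto_runningMax_upper (h : DriftConditions b C) (w : C(Time T, ℝ)) (t : Time T) :
    Tendsto (fun n ↦ runningMax (upper h w n) t) atTop (𝓝 (runningMax (upperLimit h w) t)) :=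
  ((continuous_runningMax_path t).tendsto ⟨upperLimit h w, continuous_upperLimit h w⟩).comp
    (ContinuousMap.tendsto_of_antitone_of_pointwise (antitone_upper h w) (tendsto_upper h w))

theorem tendsto_runningMax_lower (h : DriftConditions b C) (w : C(Time T, ℝ)) (t : Time T) :
    Tendsto (fun n ↦ runningMax (lower h w n) t) atTop (𝓝 (runningMax (lowerLimit h w) t)) :=
  ((continuous_runningMax_path t).tendsto ⟨lowerLimit h w, continuous_lowerLimit h w⟩).comp
    (ContinuousMap.tendsto_of_monotone_of_pointwise (monotone_lower h w) (tendsto_lower h w))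

/-- Where both the state and the running maximum are strictly ordered, the limiting drifts are
ordered, however discontinuous `b` is: the iterates are eventually ordered themselves. -/
theorem upperDrift_le_lowerDrift (h : DriftConditions b C) {w w' : C(Time T, ℝ)} {s : Time T}
    (hstate : upperLimit h w s < lowerLimit h w' s)
    (hmax : runningMax (upperLimit h w) s < runningMax (lowerLimit h w') s) :
    upperDrift h w s ≤ lowerDrift h w' s := by
  refine le_of_tendsto_of_tendsto (tendsto_pathDrift_upper h w s)
    (tendsto_pathDrift_lower h w' s) ?_
  filter_upwards [(tendsto_upper h w s).eventually_lt (tendsto_lower h w' s) hstate,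
    (tendsto_runningMax_upper h w s).eventually_lt (tendsto_runningMax_lower h w' s) hmax]
    with n h1 h2
  exact h.le_of_le s h2.le h1.le

/-- If `w'` is `w` shifted by the path `c min(·, δ)`, with a slope `c` beyond twice the size of the
drift, then the lower limit for `w'` dominates the upper limit for `w`: on `(0, δ]` the shift
separates the two, and afterwards monotonicity of the drift keeps them apart. That `w` exceeds its
initial value before `δ` is needed to separate the running maxima as well. -/
theorem upperLimit_le_lowerLimit_of_shift (h : DriftConditions b C) {w w' : C(Time T, ℝ)}
    {o δ : Time T} (ho : (o : ℝ) = 0) (hδ : 0 < (δ : ℝ)) {c ρ : ℝ}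
    (hw' : ∀ t : Time T, w' t = w t + c * min (t : ℝ) δ)
    (hρ : ∀ t, C * (1 + barrier C w t) ≤ ρ) (hρ' : ∀ t, C * (1 + barrier C w' t) ≤ ρ)
    (hc : 2 * ρ < c) (hex : ∃ r ≤ δ, w o < w r) (t : Time T) :
    upperLimit h w t ≤ lowerLimit h w' t := by
  have hρ0 : 0 ≤ ρ := (mul_nonneg h.pos.le
    (by linarith [one_le_barrier h.pos w t])).trans (hρ t)
  have hintU := integrable_upperDrift h w
  have hintL := integrable_lowerDrift h w'
  have hU : ∀ s, |upperDrift h w s| ≤ ρ := fun s ↦ (abs_upperDrift_le h w s).trans (hρ s)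
  have hL : ∀ s, |lowerDrift h w' s| ≤ ρ := fun s ↦ (abs_lowerDrift_le h w' s).trans (hρ' s)
  have hU' : ∀ t : Time T, ∫ s in Iic t, upperDrift h w s ∂lebesgue T ≤ ρ * t := fun t ↦ by
    rw [← setIntegral_Iic_const]
    exact setIntegral_Iic_mono_fun hintU (integrable_const _) fun s _ ↦ (abs_le.1 (hU s)).2
  have hL' : ∀ t : Time T, -ρ * t ≤ ∫ s in Iic t, lowerDrift h w' s ∂lebesgue T := fun t ↦ by
    rw [← setIntegral_Iic_const]
    exact setIntegral_Iic_mono_fun (integrable_const _) hintL fun s _ ↦ (abs_le.1 (hL s)).1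
  set f : Time T → ℝ := fun t ↦ lowerLimit h w' t - upperLimit h w t with hf
  have hfc : Continuous f := (continuous_lowerLimit h w').sub (continuous_upperLimit h w)
  have hf_eq : ∀ t, f t = c * min (t : ℝ) δ
      + ∫ s in Iic t, (lowerDrift h w' s - upperDrift h w s) ∂lebesgue T := fun t ↦ by
    rw [integral_sub hintL.integrableOn hintU.integrableOn]
    simp only [hf, lowerLimit_eq, upperLimit_eq, hw']
    ring
  have hpos_iff : ∀ s : Time T, o < s ↔ 0 < (s : ℝ) := fun s ↦ by
    rw [← Subtype.coe_lt_coe, ho]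
  -- On `(0, δ]` the shift `c t` outweighs the drifts, which contribute at least `-2 ρ t`.
  have hsmall : ∀ t ≤ δ, o < t → 0 < f t := by
    intro t htδ hot
    have ht0 := (hpos_iff t).1 hot
    have h1 := hU' t
    have h2 := hL' t
    rw [hf_eq, integral_sub hintL.integrableOn hintU.integrableOn,
      min_eq_left (show (t : ℝ) ≤ δ from htδ)]
    nlinarith
  have hmax : ∀ s, δ ≤ s → (∀ r ≤ s, o < r → 0 < f r) →
      runningMax (upperLimit h w) s < runningMax (lowerLimit h w') s := by
    intro s hδs hs
    obtain ⟨r, hr, hreq⟩ := exists_runningMax_eq (continuous_upperLimit h w) s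
    rw [hreq]
    rcases lt_or_ge o r with hor | hor
    · exact (sub_pos.1 (hs r hr hor)).trans_le (le_runningMax (continuous_lowerLimit h w') hr)
    -- If the maximum of the upper limit is its initial value, it is beaten by a value of the lower
    -- limit at a time before `δ` at which `w` exceeds `w o`.
    · have hr0 : (r : ℝ) = 0 := le_antisymm ((Subtype.coe_le_coe.2 hor).trans ho.le) r.2.1
      obtain rfl : r = o := Subtype.ext (hr0.trans ho.symm)
      obtain ⟨q, hqδ, hq⟩ := hex
      have h1 : upperLimit h w r = w r := by
        rw [upperLimit_eq, setIntegral_Iic_lebesgue_eq_zero ho, add_zero]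
      have h2 : w q ≤ lowerLimit h w' q := by
        have := hL' q
        have hqδ' : (q : ℝ) ≤ δ := hqδ
        have := q.2.1
        rw [lowerLimit_eq, hw', min_eq_left hqδ']
        nlinarith
      calc upperLimit h w r < w q := h1 ▸ hq
        _ ≤ lowerLimit h w' q := h2
        _ ≤ _ := le_runningMax (continuous_lowerLimit h w') (hqδ.trans hδs)
  -- Since `f o = 0`, continuous induction has to start at `δ`, hence the argument `max t δ`.
  have hlarge : ∀ t, 0 < f (max t δ) := by
    refine forall_pos_of_forall_lt (hfc.comp (continuous_id.max continuous_const)) fun t ht ↦ ?_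
    rcases le_or_gt t δ with htδ | htδ
    · rw [max_eq_right htδ]
      exact hsmall δ le_rfl ((hpos_iff δ).2 hδ)
    rw [max_eq_left htδ.le]
    have hbefore : ∀ s < t, o < s → 0 < f s := by
      intro s hs hos
      rcases le_or_gt s δ with hsδ | hsδ
      · exact hsmall s hsδ hos
      · simpa [max_eq_left hsδ.le] using ht s hs
    have hdrift : ∀ s < t, δ < s → upperDrift h w s ≤ lowerDrift h w' s := fun s hs hδs ↦
      upperDrift_le_lowerDrift h
        (sub_pos.1 (hbefore s hs (((hpos_iff δ).2 hδ).trans hδs)))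
        (hmax s hδs.le fun r hr hor ↦ hbefore r (hr.trans_lt hs) hor)
    have hg : Integrable (fun s ↦ lowerDrift h w' s - upperDrift h w s) (lebesgue T) :=
      hintL.sub hintU
    have hmono : ∫ s in Iic δ, (lowerDrift h w' s - upperDrift h w s) ∂lebesgue T
        ≤ ∫ s in Iic t, (lowerDrift h w' s - upperDrift h w s) ∂lebesgue T := by
      have h1 := setIntegral_Iic_mono_fun (hg.indicator (measurableSet_Iic (a := δ))) hg (t := t)
        fun s hs ↦ by
          by_cases hsδ : s ≤ δ
          · rw [indicator_of_mem (mem_Iic.2 hsδ)]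
          · rw [indicator_of_notMem (by simpa using hsδ)]
            exact sub_nonneg.2 (hdrift s hs (not_le.1 hsδ))
      rwa [setIntegral_indicator measurableSet_Iic, Iic_inter_Iic, inf_eq_right.2 htδ.le] at h1
    have hfδ := hsmall δ le_rfl ((hpos_iff δ).2 hδ)
    rw [hf_eq, min_self] at hfδ
    rw [hf_eq, min_eq_right (show (δ : ℝ) ≤ t from htδ.le)]
    linarith
  rcases le_or_gt t δ with htδ | htδ
  · rcases lt_or_ge o t with hot | hot
    · exact (sub_pos.1 (hsmall t htδ hot)).le
    · have ht0 : (t : ℝ) = 0 := le_antisymm ((Subtype.coe_le_coe.2 hot).trans ho.le) t.2.1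
      rw [upperLimit_eq, lowerLimit_eq, setIntegral_Iic_lebesgue_eq_zero ht0,
        setIntegral_Iic_lebesgue_eq_zero ht0, hw', ht0, min_eq_left hδ.le]
      simp
  · simpa [max_eq_left htδ.le] using (sub_pos.1 (hlarge t)).le

end MaxSDE

/-! ### Brownian motion as a random continuous path -/

namespace MaxSDE

open Set Filter Topology

variable {T : ℝ} {Ω : Type*} {m : MeasurableSpace Ω} {P : Measure Ω}

theorem IsBrownianMotion.hasIndepIncrements [IsProbabilityMeasure P] {𝓕 : Filtration (Time T) m}
    {B : Time T → Ω → ℝ} (hB : IsBrownianMotion 𝓕 P B) : HasIndepIncrements B P := by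
  refine HasIndepIncrements.of_nat fun t ht _ ↦ ?_
  rw [iIndepFun_iff_iIndep, iIndep_iff]
  intro S
  induction S using Finset.induction_on_max with
  | empty => simp
  | insert a S ha ih =>
    intro f hf
    have hfS := fun i (hi : i ∈ S) ↦ hf i (Finset.mem_insert_of_mem hi)
    have haS : a ∉ S := fun h ↦ (ha a h).false
    rw [Finset.set_biInter_insert, Finset.prod_insert haS, ← ih hfS]
    refine (Indep_iff _ _ _).1 (hB.increment_indep (t a) (t (a + 1)) (ht (Nat.le_succ a))) _ _
      (hf a (Finset.mem_insert_self a S)) ?_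
    refine Finset.measurableSet_biInter _ fun i hi ↦ ?_
    have hmeas : Measurable[𝓕 (t a)] fun ω ↦ B (t (i + 1)) ω - B (t i) ω :=
      ((hB.adapted _).mono (𝓕.mono (ht (ha i hi)))).measurable.sub
        ((hB.adapted _).mono (𝓕.mono (ht (ha i hi).le))).measurable
    exact hmeas.comap_le _ (hfS i hi)

/-- A random continuous path with the law of Brownian motion on `[0, T]`. -/
structure IsBrownianPath (P : Measure Ω) (W : Ω → C(Time T, ℝ)) : Prop where
  measurable : Measurable W
  start_zero : ∀ ω (o : Time T), (o : ℝ) = 0 → W ω o = 0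
  gaussian : IsGaussianProcess (fun t ω ↦ W ω t) P
  law : ∀ t : Time T, HasLaw (fun ω ↦ W ω t) (gaussianReal 0 (t : ℝ).toNNReal) P
  covariance : ∀ s t : Time T, cov[fun ω ↦ W ω s, fun ω ↦ W ω t; P] = min (s : ℝ) t

/-- A Brownian motion has a version all of whose paths are continuous and start at `0`; it is
adapted to the completed natural filtration since only a null set has to be modified. -/
theorem IsBrownianMotion.exists_isBrownianPath (hT : 0 < T) [IsProbabilityMeasure P]
    {𝓕 : Filtration (Time T) m} {B : Time T → Ω → ℝ} (hB : IsBrownianMotion 𝓕 P B) :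
    ∃ W : Ω → C(Time T, ℝ), IsBrownianPath P W ∧ (∀ᵐ ω ∂P, ∀ t, W ω t = B t ω) ∧
      ∀ s t, s ≤ t →
        Measurable[completedNaturalFiltration P B hB.stronglyMeasurable t] fun ω ↦ W ω s := by
  classical
  let o : Time T := ⟨0, le_rfl, hT.le⟩
  obtain ⟨N, hNsub, hNmeas, hN0⟩ := exists_measurable_superset_of_null
    (ae_iff.1 (hB.continuous_paths.and (hB.start_zero o rfl)))
  have hNc : ∀ ω, ω ∉ N → Continuous (fun t ↦ B t ω) ∧ B o ω = 0 := fun ω hω ↦ by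
    by_contra hneg
    exact hω (hNsub hneg)
  let W : Ω → C(Time T, ℝ) := fun ω ↦ if hω : ω ∈ N then 0 else ⟨fun t ↦ B t ω, (hNc ω hω).1⟩
  have hWB : ∀ ω, ω ∉ N → ∀ t, W ω t = B t ω := fun ω hω t ↦ by simp [W, hω]
  have hWN : ∀ t, (fun ω ↦ W ω t) = Nᶜ.indicator (B t) := fun t ↦ by
    ext ω
    by_cases hω : ω ∈ N
    · simp [W, hω]
    · simp [W, hω]
  have hae : ∀ᵐ ω ∂P, ∀ t, W ω t = B t ω := by
    filter_upwards [measure_eq_zero_iff_ae_notMem.1 hN0] with ω hω using hWB ω hω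
  have haet : ∀ t, (fun ω ↦ W ω t) =ᵐ[P] B t := fun t ↦ hae.mono fun ω hω ↦ hω t
  have hlaw : ∀ t : Time T, HasLaw (fun ω ↦ W ω t) (gaussianReal 0 (t : ℝ).toNNReal) P := fun t ↦ by
    have h1 := hB.increment_law o t t.2.1
    simp only [show (o : ℝ) = 0 from rfl, sub_zero] at h1
    refine h1.congr ?_
    filter_upwards [haet t, hB.start_zero o rfl] with ω h2 h3
    rw [h2, h3, sub_zero]
  have hincr : HasIndepIncrements (fun t ω ↦ W ω t) P := fun n t ht ↦
    (hB.hasIndepIncrements n t ht).congr fun i ↦ by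
      filter_upwards [hae] with ω hω
      rw [hω, hω]
  have hgauss : IsGaussianProcess (fun t ω ↦ W ω t) P := by
    let : OrderBot (Time T) := { bot := o, bot_le := fun t ↦ t.2.1 }
    refine hincr.isGaussianProcess (fun t ↦ (hlaw t).hasGaussianLaw) ?_
    filter_upwards [haet o, hB.start_zero o rfl] with ω h1 h2
    exact h1.trans h2
  have hL2 : ∀ t : Time T, MemLp (fun ω ↦ W ω t) 2 P := fun t ↦ (hlaw t).hasGaussianLaw.memLp_two
  have hcov : ∀ s t : Time T, s ≤ t → cov[fun ω ↦ W ω s, fun ω ↦ W ω t; P] = (s : ℝ) := by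
    intro s t hst
    have h0 : ∀ᵐ ω ∂P, W ω o = 0 := by
      filter_upwards [haet o, hB.start_zero o rfl] with ω h1 h2
      exact h1.trans h2
    have h1 := (hincr.indepFun_eval_sub (s := s) s.2.1 hst h0).covariance_eq_zero (hL2 s)
      ((hL2 t).sub (hL2 s))
    rw [covariance_sub_right (hL2 s) (hL2 t) (hL2 s), covariance_self (hL2 s).aemeasurable,
      (hlaw s).variance_eq, variance_id_gaussianReal, sub_eq_zero] at h1
    rw [h1, Real.coe_toNNReal _ s.2.1]
  have hadapt : ∀ s t, s ≤ t →
      Measurable[completedNaturalFiltration P B hB.stronglyMeasurable t] fun ω ↦ W ω s := by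
    intro s t hst
    have hBs : Measurable[completedNaturalFiltration P B hB.stronglyMeasurable t] (B s) :=
      ((Filtration.stronglyAdapted_natural hB.stronglyMeasurable s).mono
        (((Filtration.natural B hB.stronglyMeasurable).mono hst).trans le_sup_left)).measurable
    have hN : MeasurableSet[completedNaturalFiltration P B hB.stronglyMeasurable t] N :=
      (le_sup_right : nullSigmaAlgebra P ≤ _) _
        (MeasurableSpace.measurableSet_generateFrom ⟨hNmeas, hN0⟩)
    rw [hWN]
    exact hBs.indicator hN.compl
  refine ⟨W, ⟨?_, ?_, hgauss, hlaw, ?_⟩, hae, hadapt⟩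
  · exact measurable_path_iff.2 fun t ↦
      (hadapt t t le_rfl).mono (Filtration.le _ t) le_rfl
  · intro ω q hq
    obtain rfl : q = o := Subtype.ext hq
    by_cases hω : ω ∈ N
    · simp [W, hω]
    · rw [hWB ω hω, (hNc ω hω).2]
  · intro s t
    rcases le_total s t with hst | hts
    · rw [hcov s t hst, min_eq_left (show (s : ℝ) ≤ t from hst)]
    · rw [covariance_comm, hcov t s hts, min_eq_right (show (t : ℝ) ≤ s from hts)]

theorem IsBrownianPath.measurable_eval {W : Ω → C(Time T, ℝ)} (hW : IsBrownianPath P W)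
    (t : Time T) : Measurable fun ω ↦ W ω t :=
  (measurable_eval_path t).comp hW.measurable

theorem IsBrownianPath.memLp_two {W : Ω → C(Time T, ℝ)} (hW : IsBrownianPath P W) (t : Time T) :
    MemLp (fun ω ↦ W ω t) 2 P :=
  (hW.law t).hasGaussianLaw.memLp_two

/-- A path `F` and a variable `G` that are linear in the Brownian path are jointly Gaussian, so
they are independent as soon as they are uncorrelated. -/
theorem IsBrownianPath.indepFun_of_uncorrelated {W : Ω → C(Time T, ℝ)} (hW : IsBrownianPath P W)
    {F : Ω → C(Time T, ℝ)} {G : Ω → ℝ} (φ : Time T → Time T) (c : Time T → ℝ) (p q : Time T)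
    (α β : ℝ) (hF : ∀ ω t, F ω t = W ω (φ t) - c t * W ω p)
    (hG : ∀ ω, G ω = α * W ω p - β * W ω q)
    (h : ∀ t, α * min (φ t : ℝ) p - β * min (φ t : ℝ) q = c t * (α * p - β * min (p : ℝ) q)) :
    IndepFun F G P := by
  classical
  have hprob := hW.gaussian.isProbabilityMeasure
  have hFt : ∀ t, (fun ω ↦ F ω t) = fun ω ↦ W ω (φ t) - c t * W ω p :=
    fun t ↦ funext fun ω ↦ hF ω t
  have hG' : G = fun ω ↦ α * W ω p - β * W ω q := funext hG
  have hFm : ∀ t, Measurable fun ω ↦ F ω t := fun t ↦ by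
    rw [hFt]
    exact (hW.measurable_eval _).sub ((hW.measurable_eval _).const_mul _)
  have hGm : Measurable G := by
    rw [hG']
    exact ((hW.measurable_eval _).const_mul _).sub ((hW.measurable_eval _).const_mul _)
  have hjoint : IsGaussianProcess (Sum.elim (fun t ω ↦ F ω t) (fun (_ : Unit) ↦ G)) P := by
    refine hW.gaussian.of_isGaussianProcess ?_
    rintro (t | u)
    · refine ⟨{φ t, p}, ContinuousLinearMap.proj ⟨φ t, by simp⟩
        - c t • ContinuousLinearMap.proj ⟨p, by simp⟩, fun ω ↦ ?_⟩
      simp [hF]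
    · refine ⟨{p, q}, α • ContinuousLinearMap.proj ⟨p, by simp⟩
        - β • ContinuousLinearMap.proj ⟨q, by simp⟩, fun ω ↦ ?_⟩
      simp [hG]
  have hind := hjoint.indepFun_of_covariance_eq_zero (fun t ↦ (hFm t).aemeasurable)
    (fun _ ↦ hGm.aemeasurable) fun t _ ↦ by
      have h2 := hW.memLp_two
      rw [hFt, hG', covariance_fun_sub_fun_sub (h2 _) ((h2 _).const_mul _) ((h2 _).const_mul _)
        ((h2 _).const_mul _)]
      simp only [covariance_const_mul_left, covariance_const_mul_right, hW.covariance, min_self]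
      linear_combination h t
  have h1 : IndepFun (fun ω t ↦ F ω t) G P :=
    hind.comp measurable_id (measurable_pi_apply ())
  rw [IndepFun_iff_Indep] at h1 ⊢
  rwa [pathMeasurableSpace, MeasurableSpace.comap_comp]

theorem IsBrownianPath.indepFun_stopPath_increment {W : Ω → C(Time T, ℝ)}
    (hW : IsBrownianPath P W) {s t : Time T} (hst : s ≤ t) :
    IndepFun (fun ω ↦ stopPath s (W ω)) (fun ω ↦ W ω t - W ω s) P := by
  refine hW.indepFun_of_uncorrelated (fun r ↦ min r s) 0 t s 1 1 (fun ω r ↦ by simp [stopPath])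
    (fun ω ↦ by simp) fun r ↦ ?_
  have h1 : ((min r s : Time T) : ℝ) ≤ s := min_le_right r s
  have h2 : (s : ℝ) ≤ t := hst
  rw [min_eq_left (h1.trans h2), min_eq_left h1]
  simp

/-! ### Quasi-invariance under Cameron–Martin shifts -/

/-- The path `t ↦ min(t, δ)`. -/
def rampPath (δ : Time T) : C(Time T, ℝ) :=
  ⟨fun t ↦ min (t : ℝ) δ, continuous_subtype_val.min continuous_const⟩

/-- The `L¹` distance between the densities of `N(a, 1)` and `N(0, 1)`. -/
noncomputable def gaussianShiftDist (a : ℝ) : ℝ :=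
  ∫ z, |gaussianPDFReal a 1 z - gaussianPDFReal 0 1 z|

theorem gaussianReal_le_add_gaussianShiftDist (a : ℝ) (D : Set ℝ) :
    gaussianReal a 1 D ≤ gaussianReal 0 1 D + ENNReal.ofReal (gaussianShiftDist a) := by
  have hint : Integrable fun z ↦ gaussianPDFReal a 1 z - gaussianPDFReal 0 1 z :=
    (integrable_gaussianPDFReal a 1).sub (integrable_gaussianPDFReal 0 1)
  rw [gaussianReal_apply_eq_integral _ one_ne_zero, gaussianReal_apply_eq_integral _ one_ne_zero,
    gaussianShiftDist, ← ENNReal.ofReal_add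
      (integral_nonneg fun z ↦ gaussianPDFReal_nonneg 0 1 z) (integral_nonneg fun z ↦ abs_nonneg _)]
  refine ENNReal.ofReal_le_ofReal ?_
  rw [← sub_le_iff_le_add', ← integral_sub (integrable_gaussianPDFReal a 1).integrableOn
    (integrable_gaussianPDFReal 0 1).integrableOn]
  calc ∫ z in D, (gaussianPDFReal a 1 z - gaussianPDFReal 0 1 z)
      ≤ ∫ z in D, |gaussianPDFReal a 1 z - gaussianPDFReal 0 1 z| :=
        integral_mono hint.integrableOn hint.abs.integrableOn fun z ↦ le_abs_self _
    _ ≤ _ := setIntegral_le_integral hint.abs (ae_of_all _ fun z ↦ abs_nonneg _)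

theorem tendsto_gaussianShiftDist : Tendsto gaussianShiftDist (𝓝 0) (𝓝 0) := by
  have hpdf : ∀ a z : ℝ, gaussianPDFReal a 1 z
      = (√(2 * Real.pi))⁻¹ * Real.exp (-(z - a) ^ 2 / 2) := fun a z ↦ by
    simp [gaussianPDFReal_def]
  have hbound : Integrable fun z : ℝ ↦
      (√(2 * Real.pi))⁻¹ * (Real.exp (1 / 2) * Real.exp (-(1 / 4) * z ^ 2)) * 2 :=
    (((integrable_exp_neg_mul_sq (by norm_num : (0 : ℝ) < 1 / 4)).const_mul _).const_mul
      _).mul_const _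
  have hle : ∀ a z : ℝ, |a| ≤ 1 → gaussianPDFReal a 1 z
      ≤ (√(2 * Real.pi))⁻¹ * (Real.exp (1 / 2) * Real.exp (-(1 / 4) * z ^ 2)) := fun a z ha ↦ by
    rw [hpdf, ← Real.exp_add]
    gcongr
    have ha2 : a ^ 2 ≤ 1 := (sq_le_one_iff_abs_le_one a).2 ha
    nlinarith [sq_nonneg (z - 2 * a)]
  have h0 : (0 : ℝ) = ∫ z, |gaussianPDFReal 0 1 z - gaussianPDFReal 0 1 z| := by simp
  conv => rhs; rw [h0]
  refine tendsto_integral_filter_of_dominated_convergence _ ?_ ?_ hbound ?_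
  · exact Eventually.of_forall fun a ↦ ((measurable_gaussianPDFReal a 1).sub
      (measurable_gaussianPDFReal 0 1)).abs.aestronglyMeasurable
  · filter_upwards [Metric.closedBall_mem_nhds (0 : ℝ) one_pos] with a ha
    refine ae_of_all _ fun z ↦ ?_
    have ha1 : |a| ≤ 1 := by simpa using ha
    have h1 := hle a z ha1
    have h2 := hle 0 z (by simp)
    have h3 := gaussianPDFReal_nonneg a 1 z
    have h4 := gaussianPDFReal_nonneg 0 1 z
    rw [Real.norm_eq_abs, abs_abs, abs_le]
    constructor <;> linarith
  · refine ae_of_all _ fun z ↦ ?_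
    simp_rw [hpdf]
    exact Continuous.tendsto (f := fun a : ℝ ↦ |(√(2 * Real.pi))⁻¹ * Real.exp (-(z - a) ^ 2 / 2)
      - (√(2 * Real.pi))⁻¹ * Real.exp (-(z - 0) ^ 2 / 2)|) (by fun_prop) 0

/-- Quantitative Cameron–Martin theorem for the directions `min(·, δ)`: the bridge
`W - (W_δ / δ) min(·, δ)` is independent of `W_δ`, so the shift only moves the Gaussian variable
`W_δ / √δ`, by the amount `a √δ`. -/
theorem IsBrownianPath.measure_add_rampPath_le {W : Ω → C(Time T, ℝ)} (hW : IsBrownianPath P W)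
    {δ : Time T} (hδ : 0 < (δ : ℝ)) (a : ℝ) {E : Set C(Time T, ℝ)} (hE : MeasurableSet E) :
    P {ω | W ω + a • rampPath δ ∈ E}
      ≤ P {ω | W ω ∈ E} + ENNReal.ofReal (gaussianShiftDist (a * √δ)) := by
  have hprob := hW.gaussian.isProbabilityMeasure
  have hsq0 : √(δ : ℝ) ≠ 0 := (Real.sqrt_pos.2 hδ).ne'
  set R : Ω → C(Time T, ℝ) := fun ω ↦ W ω - (W ω δ / δ) • rampPath δ with hR
  set Z : Ω → ℝ := fun ω ↦ W ω δ / √δ with hZ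
  have hRm : Measurable R := measurable_path_iff.2 fun t ↦
    (hW.measurable_eval t).sub (((hW.measurable_eval δ).div_const _).mul_const _)
  have hZm : Measurable Z := (hW.measurable_eval δ).div_const _
  have hind : IndepFun R Z P := by
    refine hW.indepFun_of_uncorrelated id (fun t ↦ min (t : ℝ) δ / δ) δ δ (√δ)⁻¹ 0
      (fun ω t ↦ ?_) (fun ω ↦ ?_) fun t ↦ ?_
    · simp only [hR, rampPath, ContinuousMap.sub_apply, ContinuousMap.smul_apply,
        ContinuousMap.coe_mk, smul_eq_mul, id]
      ring
    · simp only [hZ]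
      ring
    · simp only [id]
      field_simp
      ring
  have hlaw : ∀ a : ℝ, P.map (fun ω ↦ Z ω + a) = gaussianReal a 1 := fun a ↦ by
    have h1 := gaussianReal_add_const (gaussianReal_div_const (hW.law δ) (√δ)) a
    have h2 : (0 : ℝ) / √δ + a = a := by simp
    have h3 : (δ : ℝ).toNNReal / NNReal.mk (√(δ : ℝ) ^ 2) (sq_nonneg _) = 1 := by
      rw [← NNReal.coe_inj]
      simp [Real.sq_sqrt hδ.le, hδ.le, hδ.ne']
    rw [h2, h3] at h1
    exact h1.map_eq
  set Ψ : C(Time T, ℝ) × ℝ → C(Time T, ℝ) := fun p ↦ p.1 + (p.2 / √δ) • rampPath δ with hΨ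
  have hΨm : Measurable Ψ := measurable_path_iff.2 fun t ↦
    ((measurable_eval_path t).comp measurable_fst).add ((measurable_snd.div_const _).mul_const _)
  have key : ∀ a : ℝ, P {ω | W ω + a • rampPath δ ∈ E}
      = ∫⁻ r, gaussianReal (a * √δ) 1 {z | Ψ (r, z) ∈ E} ∂P.map R := fun a ↦ by
    have h1 : {ω | W ω + a • rampPath δ ∈ E} = (fun ω ↦ (R ω, Z ω + a * √δ)) ⁻¹' (Ψ ⁻¹' E) := by
      ext ω
      simp only [mem_ofPred_eq, mem_preimage]
      refine iff_of_eq (congrArg (· ∈ E) ?_)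
      ext t
      simp only [hΨ, hR, hZ, ContinuousMap.add_apply, ContinuousMap.sub_apply,
        ContinuousMap.smul_apply, smul_eq_mul]
      field_simp
      rw [Real.sq_sqrt hδ.le]
      ring
    have h2 : IndepFun R (fun ω ↦ Z ω + a * √δ) P :=
      hind.comp measurable_id (measurable_id.add_const (a * √δ))
    rw [h1, ← Measure.map_apply (hRm.prodMk (hZm.add_const _)) (hΨm hE),
      h2.map_prod_eq_prod_map_map hRm.aemeasurable (hZm.add_const _).aemeasurable, hlaw,
      Measure.prod_apply (hΨm hE)]
    rfl
  have key0 := key 0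
  simp only [zero_smul, add_zero, zero_mul] at key0
  have hRprob : IsProbabilityMeasure (P.map R) := Measure.isProbabilityMeasure_map hRm.aemeasurable
  rw [key, key0]
  calc ∫⁻ r, gaussianReal (a * √δ) 1 {z | Ψ (r, z) ∈ E} ∂P.map R
      ≤ ∫⁻ r, (gaussianReal 0 1 {z | Ψ (r, z) ∈ E}
          + ENNReal.ofReal (gaussianShiftDist (a * √δ))) ∂P.map R :=
        lintegral_mono fun r ↦ gaussianReal_le_add_gaussianShiftDist _ _
    _ = _ := by rw [lintegral_add_right _ measurable_const]; simp

end MaxSDE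

/-! ### Brownian motion exceeds its initial value immediately -/

namespace MaxSDE

open Set Filter Topology

variable {T : ℝ} {Ω : Type*} {m : MeasurableSpace Ω} {P : Measure Ω}

theorem gaussianReal_Iic_one_lt_one : gaussianReal 0 1 (Iic 1) < 1 := by
  refine lt_of_le_of_ne prob_le_one fun h ↦ ?_
  have h1 : gaussianReal 0 1 (Iic 1)ᶜ = 0 := (prob_compl_eq_zero_iff measurableSet_Iic).2 h
  have h2 := gaussianReal_absolutelyContinuous' 0 one_ne_zero h1
  simp at h2

theorem measurableSet_forall_le_mul_nonpos (σ : ℝ) (t : Time T) :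
    MeasurableSet {w : C(Time T, ℝ) | ∀ r ≤ t, σ * w r ≤ 0} := by
  have hmeas : Measurable fun w : C(Time T, ℝ) ↦ runningMax (σ • w) t :=
    (measurable_runningMax_path t).comp
      (f := fun w : C(Time T, ℝ) ↦ σ • w)
      (measurable_path_iff.2 fun s ↦ (measurable_eval_path s).const_mul σ)
  convert hmeas (measurableSet_Iic (a := (0 : ℝ))) using 1
  ext w
  simp only [mem_preimage, mem_Iic, mem_ofPred_eq]
  exact ⟨fun h ↦ runningMax_le fun r hr ↦ h r hr,
    fun h r hr ↦ (le_runningMax (σ • w).continuous hr).trans h⟩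

/-- Let `p` be the supremum over `δ > 0` of the probabilities that the path stays nonpositive up to
time `δ`. Independence of the increment after `δ' ≪ δ` from the path before `δ'` gives
`p ≤ θ p` with `θ < 1`, hence `p = 0`. -/
theorem IsBrownianPath.ae_exists_le_mul_pos {W : Ω → C(Time T, ℝ)} (hW : IsBrownianPath P W)
    {σ : ℝ} (hσ : σ ≠ 0) {δ : Time T} (hδ : 0 < (δ : ℝ)) :
    ∀ᵐ ω ∂P, ∃ r ≤ δ, 0 < σ * W ω r := by
  have hprob := hW.gaussian.isProbabilityMeasure
  set A : Time T → Set Ω := fun t ↦ {ω | ∀ r ≤ t, σ * W ω r ≤ 0} with hA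
  set θ := gaussianReal 0 1 (Iic 1) with hθ
  set p : ℝ≥0∞ := ⨆ t : {t : Time T // 0 < (t : ℝ)}, P (A t) with hp
  have hp1 : p ≤ 1 := iSup_le fun _ ↦ prob_le_one
  have hscale : ∀ t : Time T, 0 < (t : ℝ) → P {ω | σ * W ω t ≤ |σ| * √t} = θ := by
    intro t ht
    have hlaw := gaussianReal_div_const (gaussianReal_const_mul (hW.law t) σ) (|σ| * √t)
    have hpos : 0 < |σ| * √(t : ℝ) := mul_pos (abs_pos.2 hσ) (Real.sqrt_pos.2 ht)
    have hmean : σ * 0 / (|σ| * √(t : ℝ)) = 0 := by simp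
    have hvar : NNReal.mk (σ ^ 2) (sq_nonneg _) * (t : ℝ).toNNReal
        / NNReal.mk ((|σ| * √(t : ℝ)) ^ 2) (sq_nonneg _) = 1 := by
      rw [← NNReal.coe_inj]
      have : σ ^ 2 * (t : ℝ) ≠ 0 := by positivity
      simp [mul_pow, Real.sq_sqrt ht.le, ht.le, this]
    rw [hmean, hvar] at hlaw
    rw [hθ, ← hlaw.map_eq, Measure.map_apply_of_aemeasurable hlaw.aemeasurable measurableSet_Iic]
    congr 1
    ext ω
    simp [div_le_one hpos]
  have hstep : ∀ s t : Time T, 0 < (s : ℝ) → s ≤ t → 0 < (t : ℝ) →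
      P (A t) ≤ p * (θ + P {ω | |σ| * √t / 2 ≤ ‖σ * W ω s‖})
        + P {ω | |σ| * √t / 2 ≤ ‖σ * W ω s‖} := by
    intro s t hs hst ht
    set K := |σ| * √(t : ℝ) / 2 with hK
    set Q : Set Ω := {ω | K ≤ ‖σ * W ω s‖} with hQ
    have hsub : A t ⊆ (A s ∩ {ω | σ * (W ω t - W ω s) ≤ K}) ∪ Q := by
      intro ω hω
      by_cases hq : ω ∈ Q
      · exact Or.inr hq
      refine Or.inl ⟨fun r hr ↦ hω r (hr.trans hst), ?_⟩
      have h1 : ‖σ * W ω s‖ < K := not_le.1 hq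
      have h2 := hω t le_rfl
      rw [Real.norm_eq_abs, abs_lt] at h1
      simp only [mem_ofPred_eq]
      linarith
    have hsub' : {ω | σ * (W ω t - W ω s) ≤ K} ⊆ {ω | σ * W ω t ≤ |σ| * √t} ∪ Q := by
      intro ω hω
      by_cases hq : ω ∈ Q
      · exact Or.inr hq
      refine Or.inl ?_
      have h1 : ‖σ * W ω s‖ < K := not_le.1 hq
      have h2 : σ * (W ω t - W ω s) ≤ K := hω
      rw [Real.norm_eq_abs, abs_lt] at h1
      simp only [mem_ofPred_eq]
      linarith
    have hindep : P (A s ∩ {ω | σ * (W ω t - W ω s) ≤ K})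
        = P (A s) * P {ω | σ * (W ω t - W ω s) ≤ K} := by
      have hA_eq : A s = (fun ω ↦ stopPath s (W ω)) ⁻¹' {w | ∀ r ≤ s, σ * w r ≤ 0} := by
        ext ω
        simp only [hA, mem_ofPred_eq, mem_preimage]
        exact forall₂_congr fun r hr ↦ by simp [stopPath, min_eq_left hr]
      rw [hA_eq]
      exact (hW.indepFun_stopPath_increment hst).measure_inter_preimage_eq_mul _
        {y | σ * y ≤ K} (measurableSet_forall_le_mul_nonpos σ s)
        (measurableSet_le (by fun_prop) measurable_const)
    calc P (A t) ≤ P (A s) * P {ω | σ * (W ω t - W ω s) ≤ K} + P Q :=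
          (measure_mono hsub).trans ((measure_union_le _ _).trans_eq (by rw [hindep]))
      _ ≤ p * (θ + P Q) + P Q := by
          gcongr
          · exact le_iSup (fun t : {t : Time T // 0 < (t : ℝ)} ↦ P (A t)) ⟨s, hs⟩
          · exact (measure_mono hsub').trans ((measure_union_le _ _).trans_eq (by rw [hscale t ht]))
  have hcontract : ∀ t : Time T, 0 < (t : ℝ) → P (A t) ≤ p * θ := by
    intro t ht
    let τ : ℕ → Time T := fun n ↦ ⟨t / (n + 1), by positivity,
      (div_le_self ht.le (by linarith [(Nat.cast_nonneg n : (0 : ℝ) ≤ n)])).trans t.2.2⟩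
    let o : Time T := ⟨0, le_rfl, ht.le.trans t.2.2⟩
    have hτ : Tendsto τ atTop (𝓝 o) := by
      rw [tendsto_subtype_rng]
      exact (tendsto_const_div_atTop_nhds_zero_nat (t : ℝ)).comp (tendsto_add_atTop_nat 1) |>.congr
        fun n ↦ by simp [τ]
    have hq : Tendsto (fun n ↦ P {ω | |σ| * √t / 2 ≤ ‖σ * W ω (τ n)‖}) atTop (𝓝 0) := by
      have h1 : TendstoInMeasure P (fun n ω ↦ σ * W ω (τ n)) atTop fun _ ↦ (0 : ℝ) := by
        refine tendstoInMeasure_of_tendsto_ae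
          (fun n ↦ ((hW.measurable_eval (τ n)).const_mul σ).aestronglyMeasurable)
          (ae_of_all _ fun ω ↦ ?_)
        have h2 := (((W ω).continuous.tendsto o).comp hτ).const_mul σ
        rwa [hW.start_zero ω o rfl, mul_zero] at h2
      have h3 := tendstoInMeasure_iff_norm.1 h1 (|σ| * √t / 2)
        (by have := abs_pos.2 hσ; have := Real.sqrt_pos.2 ht; positivity)
      simpa using h3
    have hlim : Tendsto (fun n ↦ p * (θ + P {ω | |σ| * √t / 2 ≤ ‖σ * W ω (τ n)‖})
        + P {ω | |σ| * √t / 2 ≤ ‖σ * W ω (τ n)‖}) atTop (𝓝 (p * (θ + 0) + 0)) :=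
      (ENNReal.Tendsto.const_mul (tendsto_const_nhds.add hq)
        (Or.inr (hp1.trans_lt ENNReal.one_lt_top).ne)).add hq
    rw [add_zero, add_zero] at hlim
    refine ge_of_tendsto' hlim fun n ↦ hstep (τ n) t ?_ ?_ ht
    · exact div_pos ht (by positivity)
    · exact div_le_self ht.le (by linarith [(Nat.cast_nonneg n : (0 : ℝ) ≤ n)])
  have hp0 : p = 0 := by
    by_contra hne
    have h1 : p ≤ p * θ := iSup_le fun t ↦ hcontract t t.2
    have h2 : p * θ < p * 1 := ENNReal.mul_lt_mul_right hne (hp1.trans_lt ENNReal.one_lt_top).ne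
      gaussianReal_Iic_one_lt_one
    rw [mul_one] at h2
    exact absurd h1 (not_le.2 h2)
  have h0 : P (A δ) = 0 := le_antisymm
    ((le_iSup (fun t : {t : Time T // 0 < (t : ℝ)} ↦ P (A t)) ⟨δ, hδ⟩).trans hp0.le) bot_le
  filter_upwards [measure_eq_zero_iff_ae_notMem.1 h0] with ω hω
  simp only [hA, mem_ofPred_eq, not_forall, not_le] at hω
  obtain ⟨r, hr, hpos⟩ := hω
  exact ⟨r, hr, hpos⟩

/-! ### Second moment of the supremum of Brownian motion -/

/-- The pathwise form of Doob's `L²` inequality: the maximum of a finite sequence is controlled by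
its last term and a discrete stochastic integral. -/
theorem sq_partialSups_le (S : ℕ → ℝ) (n : ℕ) :
    partialSups S n ^ 2 ≤ 4 * S n ^ 2
      - 4 * ∑ k ∈ Finset.range n, partialSups S k * (S (k + 1) - S k) := by
  have key : partialSups S n ^ 2 / 2 ≤ partialSups S n * S n
      - ∑ k ∈ Finset.range n, partialSups S k * (S (k + 1) - S k) := by
    induction n with
    | zero =>
      simp only [partialSups_zero, Finset.range_zero, Finset.sum_empty]
      nlinarith [sq_nonneg (S 0)]
    | succ n ih =>
      rw [Finset.sum_range_succ, ← Order.succ_eq_add_one, partialSups_succ, Order.succ_eq_add_one]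
      rcases le_total (partialSups S n) (S (n + 1)) with h | h
      · rw [sup_of_le_right h]
        nlinarith [sq_nonneg (S (n + 1) - partialSups S n)]
      · rw [sup_of_le_left h]
        nlinarith
  nlinarith [sq_nonneg (partialSups S n - 2 * S n)]

theorem memLp_partialSups {S : ℕ → Ω → ℝ} (hS : ∀ k, MemLp (S k) 2 P) (n : ℕ) :
    MemLp (fun ω ↦ partialSups (fun k ↦ S k ω) n) 2 P := by
  induction n with
  | zero => simpa using hS 0
  | succ n ih =>
    simp_rw [← Order.succ_eq_add_one, partialSups_succ, Order.succ_eq_add_one]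
    exact ih.sup (hS (n + 1))

theorem integral_sq_partialSups_le [IsFiniteMeasure P] {S : ℕ → Ω → ℝ}
    (hS : ∀ k, MemLp (S k) 2 P)
    (hmart : ∀ k, ∫ ω, partialSups (fun j ↦ S j ω) k * (S (k + 1) ω - S k ω) ∂P = 0) (n : ℕ) :
    ∫ ω, partialSups (fun k ↦ S k ω) n ^ 2 ∂P ≤ 4 * ∫ ω, S n ω ^ 2 ∂P := by
  have hint : ∀ k, Integrable
      (fun ω ↦ partialSups (fun j ↦ S j ω) k * (S (k + 1) ω - S k ω)) P := fun k ↦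
    (memLp_partialSups hS k).integrable_mul ((hS (k + 1)).sub (hS k))
  have hsum : Integrable (fun ω ↦ ∑ k ∈ Finset.range n,
      partialSups (fun j ↦ S j ω) k * (S (k + 1) ω - S k ω)) P :=
    integrable_finsetSum _ fun k _ ↦ hint k
  calc ∫ ω, partialSups (fun k ↦ S k ω) n ^ 2 ∂P
      ≤ ∫ ω, (4 * S n ω ^ 2 - 4 * ∑ k ∈ Finset.range n,
          partialSups (fun j ↦ S j ω) k * (S (k + 1) ω - S k ω)) ∂P :=
        integral_mono (memLp_partialSups hS n).integrable_sq
          (((hS n).integrable_sq.const_mul 4).sub (hsum.const_mul 4))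
          fun ω ↦ sq_partialSups_le (fun k ↦ S k ω) n
    _ = 4 * ∫ ω, S n ω ^ 2 ∂P := by
        rw [integral_sub ((hS n).integrable_sq.const_mul 4) (hsum.const_mul 4),
          integral_const_mul, integral_const_mul, integral_finsetSum _ fun k _ ↦ hint k]
        simp [hmart]

theorem IsBrownianPath.integral_sq_partialSups_le {W : Ω → C(Time T, ℝ)}
    (hW : IsBrownianPath P W) (ε : ℝ) {t : ℕ → Time T} (ht : Monotone t) (n : ℕ) :
    ∫ ω, partialSups (fun k ↦ ε * W ω (t k)) n ^ 2 ∂P ≤ 4 * ∫ ω, (ε * W ω (t n)) ^ 2 ∂P := by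
  have hprob := hW.gaussian.isProbabilityMeasure
  refine MaxSDE.integral_sq_partialSups_le (S := fun k ω ↦ ε * W ω (t k))
    (fun k ↦ (hW.memLp_two _).const_mul ε) (fun k ↦ ?_) n
  have hmean : ∀ s : Time T, ∫ ω, W ω s ∂P = 0 := fun s ↦ by
    rw [(hW.law s).integral_eq, integral_id_gaussianReal]
  have hint : ∀ s : Time T, Integrable (fun ω ↦ W ω s) P := fun s ↦
    (hW.memLp_two s).integrable one_le_two
  set g : C(Time T, ℝ) → ℝ := fun w ↦ partialSups (fun j ↦ ε * w (t j)) k with hg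
  have hgm : ∀ i, Measurable fun w : C(Time T, ℝ) ↦ partialSups (fun j ↦ ε * w (t j)) i := by
    intro i
    induction i with
    | zero => simpa using (measurable_eval_path (t 0)).const_mul ε
    | succ i ih =>
      simp_rw [← Order.succ_eq_add_one, partialSups_succ, Order.succ_eq_add_one]
      exact ih.sup ((measurable_eval_path _).const_mul ε)
  have hgstop : ∀ ω, partialSups (fun j ↦ ε * W ω (t j)) k = g (stopPath (t k) (W ω)) := by
    intro ω
    rw [hg]
    simp only [partialSups_apply]
    refine Finset.sup'_congr _ rfl fun j hj ↦ ?_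
    simp [stopPath, min_eq_left (ht (Finset.mem_Iic.1 hj))]
  have hind : IndepFun (fun ω ↦ g (stopPath (t k) (W ω)))
      (fun ω ↦ ε * (W ω (t (k + 1)) - W ω (t k))) P :=
    (hW.indepFun_stopPath_increment (ht (Nat.le_succ k))).comp (hgm k)
      (measurable_const_mul ε)
  have hfrozen : Measurable fun ω ↦ stopPath (t k) (W ω) :=
    measurable_path_iff.2 fun s ↦ hW.measurable_eval (min s (t k))
  simp_rw [hgstop, ← mul_sub]
  rw [hind.integral_fun_mul_eq_mul_integral ((hgm k).comp hfrozen).aestronglyMeasurable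
    (((hW.measurable_eval _).sub (hW.measurable_eval _)).const_mul ε).aestronglyMeasurable,
    integral_const_mul, integral_sub (hint _) (hint _), hmean, hmean]
  simp

theorem IsBrownianPath.lintegral_enorm_sq_lt_top (hT : 0 < T) {W : Ω → C(Time T, ℝ)}
    (hW : IsBrownianPath P W) : ∫⁻ ω, ‖W ω‖ₑ ^ 2 ∂P < ∞ := by
  have hprob := hW.gaussian.isProbabilityMeasure
  let o : Time T := ⟨0, le_rfl, hT.le⟩
  let e : Time T := ⟨T, hT.le, le_rfl⟩
  -- The grid of mesh `T / (n + 1)`, constant equal to `T` from index `n + 1` on.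
  let t : ℕ → ℕ → Time T := fun n k ↦ ⟨min (k * (T / (n + 1))) T,
    le_min (by positivity) hT.le, min_le_right _ _⟩
  have htm : ∀ n, Monotone (t n) := fun n i j hij ↦ by
    change min ((i : ℝ) * (T / (n + 1))) T ≤ min ((j : ℝ) * (T / (n + 1))) T
    gcongr
  have hte : ∀ n, t n (n + 1) = e := fun n ↦ by
    apply Subtype.ext
    change min (((n + 1 : ℕ) : ℝ) * (T / (n + 1))) T = T
    push_cast
    rw [mul_div_cancel₀ _ (by positivity), min_self]
  -- For `ε = ±1`, the maximum over the grid of the Brownian path or of its negative.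
  let M : ℝ → ℕ → Ω → ℝ := fun ε n ω ↦ partialSups (fun k ↦ ε * W ω (t n k)) (n + 1)
  have hML : ∀ ε n, MemLp (M ε n) 2 P := fun ε n ↦
    memLp_partialSups (S := fun k ω ↦ ε * W ω (t n k)) (fun k ↦ (hW.memLp_two _).const_mul ε) _
  set K : ℝ := 4 * ∫ ω, (1 * W ω e) ^ 2 ∂P + 4 * ∫ ω, (-1 * W ω e) ^ 2 ∂P with hK
  let g : ℕ → Ω → ℝ≥0∞ := fun n ω ↦ ENNReal.ofReal (M 1 n ω ^ 2 + M (-1) n ω ^ 2)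
  have hg : ∀ n, ∫⁻ ω, g n ω ∂P ≤ ENNReal.ofReal K := fun n ↦ by
    have hi : Integrable (fun ω ↦ M 1 n ω ^ 2 + M (-1) n ω ^ 2) P :=
      (hML 1 n).integrable_sq.add (hML (-1) n).integrable_sq
    rw [← ofReal_integral_eq_lintegral_ofReal hi (ae_of_all _ fun ω ↦ by positivity),
      integral_add (hML 1 n).integrable_sq (hML (-1) n).integrable_sq]
    refine ENNReal.ofReal_le_ofReal (add_le_add ?_ ?_)
    · have := hW.integral_sq_partialSups_le 1 (htm n) (n + 1)
      rwa [hte] at this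
    · have := hW.integral_sq_partialSups_le (-1) (htm n) (n + 1)
      rwa [hte] at this
  have hpoint : ∀ ω, ‖W ω‖ₑ ^ 2 ≤ liminf (fun n ↦ g n ω) atTop := by
    intro ω
    obtain ⟨s, hs⟩ : ∃ s, ‖W ω‖ = ‖W ω s‖ := by
      have : Nonempty (Time T) := ⟨o⟩
      obtain ⟨s, -, hs⟩ := isCompact_univ.exists_isMaxOn univ_nonempty
        (W ω).continuous.norm.continuousOn
      exact ⟨s, le_antisymm (((W ω).norm_le (norm_nonneg _)).2 fun r ↦ hs (mem_univ r))
        ((W ω).norm_coe_le_norm s)⟩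
    let k : ℕ → ℕ := fun n ↦ ⌊(s : ℝ) / (T / (n + 1))⌋₊
    have hk : Tendsto (fun n ↦ t n (k n)) atTop (𝓝 s) := by
      rw [tendsto_subtype_rng]
      have hstep : Tendsto (fun n : ℕ ↦ T / (n + 1)) atTop (𝓝 0) :=
        ((tendsto_const_div_atTop_nhds_zero_nat T).comp (tendsto_add_atTop_nat 1)).congr
          fun n ↦ by simp
      have hlow : Tendsto (fun n : ℕ ↦ (s : ℝ) - T / (n + 1)) atTop (𝓝 s) := by
        simpa using hstep.const_sub (s : ℝ)
      refine tendsto_of_tendsto_of_tendsto_of_le_of_le hlow tendsto_const_nhds (fun n ↦ ?_)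
        fun n ↦ ?_
      · have hh : 0 < T / ((n : ℝ) + 1) := by positivity
        have h1 := Nat.lt_floor_add_one ((s : ℝ) / (T / (n + 1)))
        rw [div_lt_iff₀ hh] at h1
        refine le_min ?_ (by linarith [s.2.2])
        simp only [k]
        linarith
      · have hh : 0 < T / ((n : ℝ) + 1) := by positivity
        have h1 := Nat.floor_le (div_nonneg s.2.1 hh.le)
        rw [le_div_iff₀ hh] at h1
        exact (min_le_left _ _).trans h1
    have hkn : ∀ n, k n ≤ n + 1 := fun n ↦ by
      have hh : 0 < T / ((n : ℝ) + 1) := by positivity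
      refine Nat.floor_le_of_le ?_
      rw [div_le_iff₀ hh]
      push_cast
      rw [mul_div_cancel₀ _ (by positivity)]
      exact s.2.2
    have hle : ∀ n, ‖W ω (t n (k n))‖ₑ ^ 2 ≤ g n ω := fun n ↦ by
      have h1 : 1 * W ω (t n (k n)) ≤ M 1 n ω :=
        le_partialSups_of_le (fun k ↦ 1 * W ω (t n k)) (hkn n)
      have h2 : -1 * W ω (t n (k n)) ≤ M (-1) n ω :=
        le_partialSups_of_le (fun k ↦ -1 * W ω (t n k)) (hkn n)
      rw [← ofReal_norm, ← ENNReal.ofReal_pow (norm_nonneg _), Real.norm_eq_abs, sq_abs]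
      refine ENNReal.ofReal_le_ofReal ?_
      rcases le_total 0 (W ω (t n (k n))) with h | h
      · nlinarith [sq_nonneg (M (-1) n ω)]
      · nlinarith [sq_nonneg (M 1 n ω)]
    have hlim : Tendsto (fun n ↦ ‖W ω (t n (k n))‖ₑ ^ 2) atTop (𝓝 (‖W ω s‖ₑ ^ 2)) :=
      ENNReal.Tendsto.pow ((((W ω).continuous.tendsto s).comp hk).enorm)
    have hs' : ‖W ω‖ₑ = ‖W ω s‖ₑ := by
      rw [← ofReal_norm, hs, ofReal_norm]
    rw [hs', ← hlim.liminf_eq]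
    exact liminf_le_liminf (Eventually.of_forall hle)
  calc ∫⁻ ω, ‖W ω‖ₑ ^ 2 ∂P ≤ ∫⁻ ω, liminf (fun n ↦ g n ω) atTop ∂P := lintegral_mono hpoint
    _ ≤ liminf (fun n ↦ ∫⁻ ω, g n ω ∂P) atTop := lintegral_liminf_le' fun n ↦
        ((hML 1 n).integrable_sq.add (hML (-1) n).integrable_sq).aemeasurable.ennreal_ofReal
    _ ≤ ENNReal.ofReal K := (liminf_le_liminf (Eventually.of_forall hg)).trans_eq (liminf_const _)
    _ < ∞ := ENNReal.ofReal_lt_top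

end MaxSDE

/-! ### Existence and uniqueness -/

namespace MaxSDE

open Set Filter Topology

variable {T : ℝ} {b : Time T → ℝ → ℝ → ℝ} {C : ℝ}
  {Ω : Type*} {m : MeasurableSpace Ω} {P : Measure Ω}

/-- The path `x + σ₀ w`, the forcing term of the equation. -/
noncomputable def forcing (x σ₀ : ℝ) (w : C(Time T, ℝ)) : C(Time T, ℝ) :=
  ContinuousMap.const _ x + σ₀ • w

theorem forcing_apply (x σ₀ : ℝ) (w : C(Time T, ℝ)) (t : Time T) :
    forcing x σ₀ w t = x + σ₀ * w t := rfl

theorem measurable_forcing (x σ₀ : ℝ) : Measurable (forcing x σ₀ : C(Time T, ℝ) → C(Time T, ℝ)) :=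
  measurable_path_iff.2 fun t ↦ ((measurable_eval_path t).const_mul σ₀).const_add x

theorem barrier_add_smul_rampPath_le (hC : 0 < C) (w : C(Time T, ℝ)) {c : ℝ} (hc : 0 ≤ c)
    (δ t : Time T) :
    barrier C (w + c • rampPath δ) t ≤ barrier C w t + c * δ * Real.exp (2 * C * T) := by
  have h1 : runningMax (fun s ↦ |(w + c • rampPath δ) s|) t
      ≤ runningMax (fun s ↦ |w s|) t + c * δ := by
    refine runningMax_le fun r hr ↦ (abs_add_le _ _).trans (add_le_add ?_ ?_)
    · exact le_runningMax (w := fun s ↦ |w s|) w.continuous.abs hr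
    · change |c * min (r : ℝ) δ| ≤ c * δ
      rw [abs_of_nonneg (mul_nonneg hc (le_min r.2.1 δ.2.1))]
      exact mul_le_mul_of_nonneg_left (min_le_right _ _) hc
  have h2 : Real.exp (2 * C * t) ≤ Real.exp (2 * C * T) :=
    Real.exp_le_exp.2 (mul_le_mul_of_nonneg_left t.2.2 (by positivity))
  rw [barrier_apply, barrier_apply]
  have h3 := Real.exp_pos (2 * C * t)
  have h4 : 0 ≤ c * δ := mul_nonneg hc δ.2.1
  nlinarith

/-- The upper and lower limits are ordered pathwise, and by the comparison under a shift and
quasi-invariance of the law of Brownian motion the upper one is not stochastically larger than the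
lower one. -/
theorem IsBrownianPath.measure_lt_upperLimit_le (hT : 0 < T) {W : Ω → C(Time T, ℝ)}
    (hW : IsBrownianPath P W) (h : DriftConditions b C) (x : ℝ) {σ₀ : ℝ} (hσ₀ : σ₀ ≠ 0)
    (t : Time T) (q : ℝ) :
    P {ω | q < upperLimit h (forcing x σ₀ (W ω)) t}
      ≤ P {ω | q < lowerLimit h (forcing x σ₀ (W ω)) t} := by
  have hprob := hW.gaussian.isProbabilityMeasure
  have hC := h.pos
  let o : Time T := ⟨0, le_rfl, hT.le⟩
  let e : Time T := ⟨T, hT.le, le_rfl⟩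
  let δ : ℕ → Time T := fun n ↦ ⟨T / (n + 1), by positivity,
    div_le_self hT.le (by linarith [(Nat.cast_nonneg n : (0 : ℝ) ≤ n)])⟩
  have hδ : ∀ n, 0 < (δ n : ℝ) := fun n ↦ by
    change 0 < T / ((n : ℝ) + 1)
    positivity
  have hδ0 : Tendsto (fun n ↦ (δ n : ℝ)) atTop (𝓝 0) :=
    ((tendsto_const_div_atTop_nhds_zero_nat T).comp (tendsto_add_atTop_nat 1)).congr
      fun n ↦ by simp [δ]
  -- Off `D k`, the drift along all iterates for the forcing path is bounded by `k`.
  let D : ℕ → Set Ω := fun k ↦ {ω | (k : ℝ) < C * (1 + barrier C (forcing x σ₀ (W ω)) e)}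
  set E : Set C(Time T, ℝ) := {w | q < lowerLimit h (forcing x σ₀ w) t} with hE
  have hEm : MeasurableSet E :=
    measurableSet_lt measurable_const ((measurable_lowerLimit h t).comp (measurable_forcing x σ₀))
  have hD : Tendsto (fun k ↦ P (D k)) atTop (𝓝 0) := by
    have hmeas : Measurable fun ω ↦ C * (1 + barrier C (forcing x σ₀ (W ω)) e) :=
      (((measurable_path_iff.1 measurable_barrier e).comp
        ((measurable_forcing x σ₀).comp hW.measurable)).const_add 1).const_mul C
    have h1 := tendsto_measure_iInter_atTop (μ := P) (s := D)
      (fun k ↦ (measurableSet_lt measurable_const hmeas).nullMeasurableSet)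
      (fun i j hij ω (hω : (j : ℝ) < _) ↦ (Nat.cast_le.2 hij).trans_lt hω)
      ⟨0, measure_ne_top _ _⟩
    have h2 : ⋂ k, D k = ∅ := by
      refine eq_empty_of_forall_notMem fun ω hω ↦ ?_
      obtain ⟨k, hk⟩ := exists_nat_gt (C * (1 + barrier C (forcing x σ₀ (W ω)) e))
      exact absurd (mem_iInter.1 hω k) (not_lt.2 hk.le)
    rwa [h2, measure_empty] at h1
  have hbound : ∀ k : ℕ, P {ω | q < upperLimit h (forcing x σ₀ (W ω)) t}
      ≤ P {ω | W ω ∈ E} + P (D k) := by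
    intro k
    -- The additional `1` bounds the growth of the barrier under the shift, once `δ n` is small.
    set ρ : ℝ := k + 1 with hρ
    set c : ℝ := 2 * ρ + 1 with hc
    have hρ0 : 0 < ρ := by positivity
    have hc0 : 0 < c := by positivity
    have hsmall : ∀ᶠ n in atTop, C * (c * δ n * Real.exp (2 * C * T)) ≤ 1 := by
      have h1 : Tendsto (fun n ↦ C * (c * δ n * Real.exp (2 * C * T))) atTop (𝓝 0) := by
        simpa using ((hδ0.const_mul c).mul_const (Real.exp (2 * C * T))).const_mul C
      exact h1.eventually_le_const one_pos
    have hev : ∀ᶠ n in atTop, P {ω | q < upperLimit h (forcing x σ₀ (W ω)) t}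
        ≤ P {ω | W ω ∈ E} + ENNReal.ofReal (gaussianShiftDist (c / σ₀ * √(δ n))) + P (D k) := by
      filter_upwards [hsmall] with n hn
      have hincl : ∀ᵐ ω ∂P, q < upperLimit h (forcing x σ₀ (W ω)) t →
          ω ∈ {ω | W ω + (c / σ₀) • rampPath (δ n) ∈ E} ∪ D k := by
        filter_upwards [hW.ae_exists_le_mul_pos hσ₀ (hδ n)] with ω hω hq
        by_cases hDk : ω ∈ D k
        · exact Or.inr hDk
        refine Or.inl (hq.trans_le ?_)
        have hDk' : C * (1 + barrier C (forcing x σ₀ (W ω)) e) ≤ k := not_lt.1 hDk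
        have hshift : forcing x σ₀ (W ω + (c / σ₀) • rampPath (δ n))
            = forcing x σ₀ (W ω) + c • rampPath (δ n) := by
          ext s
          simp only [forcing_apply, ContinuousMap.add_apply, ContinuousMap.smul_apply, smul_eq_mul]
          field_simp
          ring
        rw [hshift]
        have hb : ∀ s, C * (1 + barrier C (forcing x σ₀ (W ω)) s) ≤ k := fun s ↦ by
          have := monotone_barrier hC (forcing x σ₀ (W ω)) (show s ≤ e from s.2.2)
          exact (mul_le_mul_of_nonneg_left (by linarith) hC.le).trans hDk'
        refine upperLimit_le_lowerLimit_of_shift h (o := o) (δ := δ n) (c := c) (ρ := ρ) rfl (hδ n)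
          (fun s ↦ rfl) (fun s ↦ (hb s).trans (by linarith)) (fun s ↦ ?_) (by linarith) ?_ t
        · have h1 := barrier_add_smul_rampPath_le hC (forcing x σ₀ (W ω)) hc0.le (δ n) s
          have h2 := mul_le_mul_of_nonneg_left h1 hC.le
          have h3 := hb s
          linarith
        · obtain ⟨r, hr, hpos⟩ := hω
          refine ⟨r, hr, ?_⟩
          rw [forcing_apply, forcing_apply, hW.start_zero ω o rfl]
          linarith
      calc P {ω | q < upperLimit h (forcing x σ₀ (W ω)) t}
          ≤ P ({ω | W ω + (c / σ₀) • rampPath (δ n) ∈ E} ∪ D k) := measure_mono_ae hincl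
        _ ≤ P {ω | W ω + (c / σ₀) • rampPath (δ n) ∈ E} + P (D k) := measure_union_le _ _
        _ ≤ _ := by
            gcongr
            exact hW.measure_add_rampPath_le (hδ n) _ hEm
    have hlim : Tendsto (fun n ↦ P {ω | W ω ∈ E}
        + ENNReal.ofReal (gaussianShiftDist (c / σ₀ * √(δ n))) + P (D k)) atTop
        (𝓝 (P {ω | W ω ∈ E} + ENNReal.ofReal 0 + P (D k))) := by
      have h1 : Tendsto (fun n ↦ c / σ₀ * √(δ n : ℝ)) atTop (𝓝 0) := by
        simpa using ((Real.continuous_sqrt.tendsto 0).comp hδ0).const_mul (c / σ₀)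
      exact (tendsto_const_nhds.add
        (ENNReal.tendsto_ofReal (tendsto_gaussianShiftDist.comp h1))).add tendsto_const_nhds
    rw [ENNReal.ofReal_zero, add_zero] at hlim
    exact ge_of_tendsto hlim hev
  have hlim : Tendsto (fun k ↦ P {ω | W ω ∈ E} + P (D k)) atTop (𝓝 (P {ω | W ω ∈ E} + 0)) :=
    tendsto_const_nhds.add hD
  rw [add_zero] at hlim
  exact ge_of_tendsto' hlim hbound

theorem IsBrownianPath.ae_lowerLimit_eq_upperLimit (hT : 0 < T) {W : Ω → C(Time T, ℝ)}
    (hW : IsBrownianPath P W) (h : DriftConditions b C) (x : ℝ) {σ₀ : ℝ} (hσ₀ : σ₀ ≠ 0) :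
    ∀ᵐ ω ∂P, ∀ t, lowerLimit h (forcing x σ₀ (W ω)) t = upperLimit h (forcing x σ₀ (W ω)) t := by
  have hprob := hW.gaussian.isProbabilityMeasure
  have : Nonempty (Time T) := ⟨⟨0, le_rfl, hT.le⟩⟩
  have hFm : Measurable fun ω ↦ forcing x σ₀ (W ω) := (measurable_forcing x σ₀).comp hW.measurable
  have hq : ∀ (t : Time T) (q : ℚ), ∀ᵐ ω ∂P, (q : ℝ) < upperLimit h (forcing x σ₀ (W ω)) t →
      (q : ℝ) < lowerLimit h (forcing x σ₀ (W ω)) t := by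
    intro t q
    have hsub : {ω | (q : ℝ) < lowerLimit h (forcing x σ₀ (W ω)) t}
        ⊆ {ω | (q : ℝ) < upperLimit h (forcing x σ₀ (W ω)) t} := fun ω hω ↦
      lt_of_lt_of_le hω (lowerLimit_le_upperLimit h _ t)
    have hmeas : MeasurableSet {ω | (q : ℝ) < lowerLimit h (forcing x σ₀ (W ω)) t} :=
      measurableSet_lt measurable_const ((measurable_lowerLimit h t).comp hFm)
    have hae := ae_eq_of_subset_of_measure_ge hsub (hW.measure_lt_upperLimit_le hT h x hσ₀ t q)
      hmeas.nullMeasurableSet (measure_ne_top _ _)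
    filter_upwards [hae.mem_iff] with ω hω hlt
    exact hω.2 hlt
  have hdense : ∀ᵐ ω ∂P, ∀ n,
      upperLimit h (forcing x σ₀ (W ω)) (TopologicalSpace.denseSeq (Time T) n)
      ≤ lowerLimit h (forcing x σ₀ (W ω)) (TopologicalSpace.denseSeq (Time T) n) := by
    refine ae_all_iff.2 fun n ↦ ?_
    filter_upwards [ae_all_iff.2 (hq (TopologicalSpace.denseSeq (Time T) n))] with ω hω
    by_contra hlt
    obtain ⟨q, hq1, hq2⟩ := exists_rat_btwn (not_le.1 hlt)
    exact absurd (hω q hq2) (not_lt.2 hq1.le)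
  filter_upwards [hdense] with ω hω t
  refine le_antisymm (lowerLimit_le_upperLimit h _ t) ?_
  have hcl : IsClosed {t | upperLimit h (forcing x σ₀ (W ω)) t
      ≤ lowerLimit h (forcing x σ₀ (W ω)) t} :=
    isClosed_le (continuous_upperLimit h _) (continuous_lowerLimit h _)
  exact hcl.closure_subset_iff.2 (by rintro _ ⟨n, rfl⟩; exact hω n)
    (TopologicalSpace.denseRange_denseSeq (Time T) t)

theorem IsBrownianPath.lintegral_iSup_lowerLimit_sq_lt_top (hT : 0 < T) {W : Ω → C(Time T, ℝ)}
    (hW : IsBrownianPath P W) (h : DriftConditions b C) (x σ₀ : ℝ) :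
    ∫⁻ ω, (⨆ t, ‖lowerLimit h (forcing x σ₀ (W ω)) t‖ₑ) ^ 2 ∂P < ∞ := by
  have hprob := hW.gaussian.isProbabilityMeasure
  have hC := h.pos
  set K := Real.exp (2 * C * T) with hK
  set α : ℝ≥0∞ := ENNReal.ofReal (2 * ((1 + |x|) * K) ^ 2) with hα
  set β : ℝ≥0∞ := ENNReal.ofReal (2 * (|σ₀| * K) ^ 2) with hβ
  have hpoint : ∀ ω, (⨆ t, ‖lowerLimit h (forcing x σ₀ (W ω)) t‖ₑ) ^ 2 ≤ α + β * ‖W ω‖ₑ ^ 2 := by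
    intro ω
    have h1 : ∀ t, |lowerLimit h (forcing x σ₀ (W ω)) t|
        ≤ (1 + |x| + |σ₀| * ‖W ω‖) * K := fun t ↦ by
      refine (abs_lowerLimit_le h _ t).trans ?_
      rw [barrier_apply, add_assoc]
      gcongr
      · refine runningMax_le fun r _ ↦ ?_
        rw [forcing_apply]
        refine (abs_add_le _ _).trans ?_
        rw [abs_mul]
        gcongr
        exact (W ω).norm_coe_le_norm r
      · exact Real.exp_le_exp.2 (mul_le_mul_of_nonneg_left t.2.2 (by positivity))
    have h2 : (⨆ t, ‖lowerLimit h (forcing x σ₀ (W ω)) t‖ₑ)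
        ≤ ENNReal.ofReal ((1 + |x| + |σ₀| * ‖W ω‖) * K) := iSup_le fun t ↦ by
      rw [← ofReal_norm, Real.norm_eq_abs]
      exact ENNReal.ofReal_le_ofReal (h1 t)
    calc (⨆ t, ‖lowerLimit h (forcing x σ₀ (W ω)) t‖ₑ) ^ 2
        ≤ ENNReal.ofReal ((1 + |x| + |σ₀| * ‖W ω‖) * K) ^ 2 := by gcongr
      _ = ENNReal.ofReal (((1 + |x| + |σ₀| * ‖W ω‖) * K) ^ 2) :=
          (ENNReal.ofReal_pow (by positivity) 2).symm
      _ ≤ ENNReal.ofReal (2 * ((1 + |x|) * K) ^ 2 + 2 * (|σ₀| * K) ^ 2 * ‖W ω‖ ^ 2) := by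
          refine ENNReal.ofReal_le_ofReal ?_
          nlinarith [sq_nonneg ((1 + |x|) * K - |σ₀| * K * ‖W ω‖)]
      _ = α + β * ‖W ω‖ₑ ^ 2 := by
          rw [ENNReal.ofReal_add (by positivity) (by positivity),
            ENNReal.ofReal_mul (p := 2 * (|σ₀| * K) ^ 2) (by positivity),
            ENNReal.ofReal_pow (norm_nonneg _), ofReal_norm]
  calc ∫⁻ ω, (⨆ t, ‖lowerLimit h (forcing x σ₀ (W ω)) t‖ₑ) ^ 2 ∂P
      ≤ ∫⁻ ω, (α + β * ‖W ω‖ₑ ^ 2) ∂P := lintegral_mono hpoint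
    _ = α + β * ∫⁻ ω, ‖W ω‖ₑ ^ 2 ∂P := by
        rw [lintegral_add_left measurable_const, lintegral_const_mul' _ _ ENNReal.ofReal_ne_top,
          lintegral_const, measure_univ, mul_one]
    _ < ∞ := ENNReal.add_lt_top.2 ⟨ENNReal.ofReal_lt_top,
        ENNReal.mul_lt_top ENNReal.ofReal_lt_top (hW.lintegral_enorm_sq_lt_top hT)⟩

end MaxSDE

theorem propositionA1 {T : ℝ} (hT : 0 < T) (x σ₀ : ℝ) (hσ₀ : σ₀ ≠ 0)
    (b : MaxSDE.Time T → ℝ → ℝ → ℝ)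
    (hb_meas : Measurable (fun p : MaxSDE.Time T × ℝ × ℝ ↦ b p.1 p.2.1 p.2.2))
    (hb_growth : ∃ C : ℝ, 0 < C ∧ ∀ (t : MaxSDE.Time T) (w : C(MaxSDE.Time T, ℝ)),
      |b t (MaxSDE.runningMax w t) (w t)| ≤ C * (1 + MaxSDE.runningMax (fun s ↦ |w s|) t))
    (hb_mono_max : ∀ (t : MaxSDE.Time T) (y : ℝ), Monotone (fun a ↦ b t a y))
    (hb_mono_state : ∀ (t : MaxSDE.Time T) (a : ℝ), Monotone (fun y ↦ b t a y))
    {Ω : Type*} {m : MeasurableSpace Ω} (P : Measure Ω) [IsProbabilityMeasure P]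
    (𝓕 : Filtration (MaxSDE.Time T) m) (B : MaxSDE.Time T → Ω → ℝ)
    (hB : MaxSDE.IsBrownianMotion 𝓕 P B) :
    ∃ X : MaxSDE.Time T → Ω → ℝ,
      MaxSDE.IsSolution b x σ₀ P B
        (MaxSDE.completedNaturalFiltration P B hB.stronglyMeasurable) X ∧
      ∫⁻ ω, (⨆ t : MaxSDE.Time T, ‖X t ω‖ₑ) ^ 2 ∂P < ∞ ∧
      ∀ (𝓖 : Filtration (MaxSDE.Time T) m), MaxSDE.IsBrownianMotion 𝓖 P B →
        ∀ Y : MaxSDE.Time T → Ω → ℝ, MaxSDE.IsSolution b x σ₀ P B 𝓖 Y →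
          ∀ᵐ ω ∂P, ∀ t : MaxSDE.Time T, Y t ω = X t ω := by
  obtain ⟨C, hC, hgrowth⟩ := hb_growth
  have h : MaxSDE.DriftConditions b C := ⟨hb_meas, hC, hgrowth, hb_mono_max, hb_mono_state⟩
  obtain ⟨W, hW, hWB, hadapt⟩ := hB.exists_isBrownianPath hT
  have hlimits := hW.ae_lowerLimit_eq_upperLimit hT h x hσ₀
  refine ⟨fun t ω ↦ MaxSDE.lowerLimit h (MaxSDE.forcing x σ₀ (W ω)) t, ⟨fun t ↦ ?_, ?_, ?_, ?_⟩,
    hW.lintegral_iSup_lowerLimit_sq_lt_top hT h x σ₀, fun 𝓖 _ Y hY ↦ ?_⟩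
  · have hfrozen := (MaxSDE.measurable_lowerLimit h t).comp
      (MaxSDE.measurable_path_iff.2 fun s ↦
        ((hadapt (min s t) t (min_le_right _ _)).const_mul σ₀).const_add x :
        Measurable[MaxSDE.completedNaturalFiltration P B hB.stronglyMeasurable t]
          fun ω ↦ MaxSDE.stopPath t (MaxSDE.forcing x σ₀ (W ω)))
    have heq : (fun w ↦ MaxSDE.lowerLimit h w t)
          ∘ (fun ω ↦ MaxSDE.stopPath t (MaxSDE.forcing x σ₀ (W ω)))
        = fun ω ↦ MaxSDE.lowerLimit h (MaxSDE.forcing x σ₀ (W ω)) t :=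
      funext fun ω ↦ MaxSDE.lowerLimit_stopPath h _ t
    rw [heq] at hfrozen
    exact hfrozen.stronglyMeasurable
  · exact ae_of_all _ fun ω ↦ MaxSDE.continuous_lowerLimit h _
  · exact ae_of_all _ fun ω ↦ h.integrable_pathDrift
      ⟨MaxSDE.lowerLimit h (MaxSDE.forcing x σ₀ (W ω)), MaxSDE.continuous_lowerLimit h _⟩
  · filter_upwards [hlimits, hWB] with ω hω hωB t
    have h1 := MaxSDE.lowerLimit_eq_of_eq_upperLimit h _ hω t
    rw [MaxSDE.forcing_apply, hωB t] at h1
    rw [h1, add_right_comm]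
    rfl
  · filter_upwards [hlimits, hWB, hY.continuous_paths, hY.equation] with ω hω hωB hcont heq t
    have hfix : MaxSDE.picard h (MaxSDE.forcing x σ₀ (W ω)) ⟨fun t ↦ Y t ω, hcont⟩
        = ⟨fun t ↦ Y t ω, hcont⟩ := by
      ext s
      rw [MaxSDE.picard_apply, MaxSDE.forcing_apply, hωB s, ContinuousMap.coe_mk, heq s,
        add_right_comm]
      rfl
    exact le_antisymm ((MaxSDE.le_upperLimit_of_fixedPoint h hfix t).trans_eq (hω t).symm)
      (MaxSDE.lowerLimit_le_of_fixedPoint h hfix t)
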